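/- Let $X$ be a real Hilbert space with an orthonormal basis $\varphi=\{\varphi_n\}_{n\in\mathbb N}$, and for $N\in\mathbb N$ put $E_N u=(\langle u,\varphi_1\rangle,\dots,\langle u,\varphi_N\rangle)\in\mathbb R^N$ and $D_N\alpha=\sum_{n\le N}\alpha_n\varphi_n\in X$. Let $F:X\to X$ be a layer of a bilipschitz neural operator, i.e. $F(x)=x+T_2\,G_0(T_1x)$ with compact linear operators $T_1,T_2:X\to X$ and $G_0\in C^1(X;X)$, and $c\|x_1-x_2\|\le\|F(x_1)-F(x_2)\|\le C\|x_1-x_2\|$ for all $x_1,x_2\in X$, with constants $c>0$, $C<\infty$. Let $\sigma$ be either the ReLU $\sigma(s)=\max\{0,s\}$ or the ReCU $\sigma(s)=\max\{0,s\}^3$. Then for all $\delta\in(0,1)$, $R>0$ and $\varepsilon\in(0,1)$ there are integers $T,N\ge1$, feed-forward neural networks $NN_1,\dots,NN_T:\mathbb R^N\to\mathbb R^N$ with activation function $\sigma$ (alternating compositions of affine maps and componentwise applications of $\sigma$, beginning and ending with an affine map), and a linear map $A:X\to X$ that is either the identity or a reflection $x\mapsto x-2\langle x,e\rangle e$ with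 some unit vector $e$, such that, with \[ G_t:=\mathrm{Id}_X+D_N\circ NN_t\circ E_N ,\qquad G:=G_T\circ\cdots\circ G_1 , \] the following holds. Denote by $B(0,r)$ the open ball and by $\overline B(0,r)$ the closed ball of radius $r$ in $X$. 1. $\sup_{x\in\overline B(0,R)}\|F(x)-G(A(x))\|\le\varepsilon$. 2. There is $R'>0$ such that, with $\Gamma_t:=B(0,R'+t\delta)$ for $t=0,\dots,T+1$, $\tilde K_0:=A(B(0,R))$ and $\tilde K_t:=G_t(\tilde K_{t-1})$ for $t=1,\dots,T$ (so $\tilde K_T=G\circ A(B(0,R))$), one has: (a) $\tilde K_0\subset B(0,R')$, and $\tilde K_t\subset\Gamma_t$ for $t=0,\dots,T$. (b) For $t=1,\dots,T$ the block $G_t$ is strongly monotone on $\Gamma_t$: there is $\alpha>0$ with $\langle G_t(x)-G_t(y),x-y\rangle\ge\alpha\|x-y\|^2$ for all $x,y\in\Gamma_t$. If $\sigma$ is the ReCU, then moreover $G_t:\Gamma_t\to G_t(\Gamma_t)$ is a $C^1$-diffeomorphism between open sets. (c) For $t=1,\dots,T$ the map $\phi_t(x,y):=(y-D_N(NN_t(E_N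 x)),\,y)$ maps $\Gamma_{t+1}\times\Gamma_t$ to itself; with $\pi_1(x,y)=x$ and $e_1(y)=(0,y)$, the limit \[ L_t(y):=\lim_{n\to\infty}\pi_1\circ\underbrace{\phi_t\circ\cdots\circ\phi_t}_{n}\circ e_1(y) \] exists for every $y\in\Gamma_t$ and defines a map $L_t:\Gamma_t\to\Gamma_{t+1}$, and $L_t(\tilde K_t)\subset\tilde K_{t-1}$. (d) $G\circ A:B(0,R)\to G\circ A(B(0,R))$ is bijective, $\Phi:=L_1|_{\tilde K_1}\circ\cdots\circ L_T|_{\tilde K_T}$ maps $G\circ A(B(0,R))$ into $A(B(0,R))$, and \[ (G\circ A|_{B(0,R)})^{-1}=A^{-1}\circ\Phi . \] -/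

import Mathlib

open Set Filter Topology
open scoped Matrix RealInnerProductSpace

noncomputable section

/-- The Rectified Linear Unit `x ↦ max {0, x}`. -/
def reLU (x : ℝ) : ℝ := max 0 x

/-- The Rectified Cubic Unit `x ↦ max {0, x} ^ 3`. -/
def reCU (x : ℝ) : ℝ := (max 0 x) ^ 3

/-- The affine map `x ↦ W x + b` from `ℝⁿ` to `ℝᵐ`. -/
def affineLayer {n m : ℕ} (W : Matrix (Fin m) (Fin n) ℝ) (b : EuclideanSpace ℝ (Fin m))
    (x : EuclideanSpace ℝ (Fin n)) : EuclideanSpace ℝ (Fin m) :=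
  WithLp.toLp 2 (W *ᵥ x.ofLp) + b

/-- Componentwise application of an activation function. -/
def activate (σ : ℝ → ℝ) {n : ℕ} (x : EuclideanSpace ℝ (Fin n)) : EuclideanSpace ℝ (Fin n) :=
  WithLp.toLp 2 (fun i => σ (x i))

/-- Functions realised by feed-forward neural networks (arbitrary depth and widths) with activation
function `σ`: alternating compositions of affine maps and componentwise activations, whose first
and last maps are affine. -/
inductive IsNeuralNetwork (σ : ℝ → ℝ) :
    {n m : ℕ} → (EuclideanSpace ℝ (Fin n) → EuclideanSpace ℝ (Fin m)) → Prop
  | affine {n m : ℕ} (W : Matrix (Fin m) (Fin n) ℝ) (b : EuclideanSpace ℝ (Fin m)) :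
      IsNeuralNetwork σ (affineLayer W b)
  | layer {n k m : ℕ} (W : Matrix (Fin k) (Fin n) ℝ) (b : EuclideanSpace ℝ (Fin k))
      (f : EuclideanSpace ℝ (Fin k) → EuclideanSpace ℝ (Fin m)) (hf : IsNeuralNetwork σ f) :
      IsNeuralNetwork σ (fun x => f (activate σ (affineLayer W b x)))

section Hilbert

variable {X : Type*} [NormedAddCommGroup X] [InnerProductSpace ℝ X]

/-- `F` is a layer of a neural operator: `F x = x + T₂ (G (T₁ x))` with compact linear operators
`T₁`, `T₂` and a nonlinear operator `G` of class `C¹`. -/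
def IsNeuralOperatorLayer (F : X → X) : Prop :=
  ∃ (T₁ T₂ : X →L[ℝ] X) (G : X → X),
    IsCompactOperator T₁ ∧ IsCompactOperator T₂ ∧ ContDiff ℝ 1 G ∧
      ∀ x, F x = x + T₂ (G (T₁ x))

/-- `F` is bilipschitz. -/
def IsBilipschitz (F : X → X) : Prop :=
  ∃ c C : ℝ, 0 < c ∧ ∀ x₁ x₂ : X,
    c * ‖x₁ - x₂‖ ≤ ‖F x₁ - F x₂‖ ∧ ‖F x₁ - F x₂‖ ≤ C * ‖x₁ - x₂‖

/-- `f` is strongly monotone on the set `S`. -/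
def StronglyMonotoneOn (f : X → X) (S : Set X) : Prop :=
  ∃ α : ℝ, 0 < α ∧ ∀ x ∈ S, ∀ y ∈ S, α * ‖x - y‖ ^ 2 ≤ ⟪f x - f y, x - y⟫

/-- `f : U → f(U)` is a `C¹`-diffeomorphism between open subsets of `X`. -/
def IsC1DiffeoOntoImage (f : X → X) (U : Set X) : Prop :=
  IsOpen U ∧ IsOpen (f '' U) ∧ ContDiffOn ℝ 1 f U ∧
    ∃ g : X → X, LeftInvOn g f U ∧ ContDiffOn ℝ 1 g (f '' U)

/-- `A` is the reflection `x ↦ x - 2 ⟨x, e⟩ e` in some unit vector `e`. -/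
def IsHyperplaneReflection (A : X → X) : Prop :=
  ∃ e : X, ‖e‖ = 1 ∧ ∀ x, A x = x - (2 * ⟪x, e⟫) • e

/-- `E_N u = (⟨u, φ₁⟩, …, ⟨u, φ_N⟩)` (the basis is indexed from `0` here). -/
def encode (φ : HilbertBasis ℕ ℝ X) (N : ℕ) (u : X) : EuclideanSpace ℝ (Fin N) :=
  WithLp.toLp 2 (fun i => ⟪u, φ i⟫)

/-- `D_N α = ∑_{n ≤ N} αₙ φₙ`. -/
def decode (φ : HilbertBasis ℕ ℝ X) (N : ℕ) (a : EuclideanSpace ℝ (Fin N)) : X :=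
  ∑ i : Fin N, a i • φ i

/-- The finite-rank map `D_N ∘ f ∘ E_N` on `X`. -/
def finiteRankMap (φ : HilbertBasis ℕ ℝ X) {N : ℕ}
    (f : EuclideanSpace ℝ (Fin N) → EuclideanSpace ℝ (Fin N)) (x : X) : X :=
  decode φ N (f (encode φ N x))

/-- The residual block `Id + D_N ∘ f ∘ E_N`. -/
def residualBlock (φ : HilbertBasis ℕ ℝ X) {N : ℕ}
    (f : EuclideanSpace ℝ (Fin N) → EuclideanSpace ℝ (Fin N)) (x : X) : X :=
  x + finiteRankMap φ f x

/-- `(Id + D_N ∘ NN_T ∘ E_N) ∘ ⋯ ∘ (Id + D_N ∘ NN_1 ∘ E_N)`. -/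
def residualNet (φ : HilbertBasis ℕ ℝ X) {N : ℕ}
    (NN : ℕ → EuclideanSpace ℝ (Fin N) → EuclideanSpace ℝ (Fin N)) : ℕ → X → X
  | 0 => id
  | t + 1 => residualBlock φ (NN (t + 1)) ∘ residualNet φ NN t

/-- The class `R_{T,N,φ,σ}(X)` of finite-rank residual networks. -/
def residualNetworks (T N : ℕ) (φ : HilbertBasis ℕ ℝ X) (σ : ℝ → ℝ) : Set (X → X) :=
  {G | ∃ NN : ℕ → EuclideanSpace ℝ (Fin N) → EuclideanSpace ℝ (Fin N),
    (∀ t ∈ Finset.Icc 1 T, IsNeuralNetwork σ (NN t)) ∧ G = residualNet φ NN T}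

/-- The iteration map `(x, y) ↦ (y - D_N (f (E_N x)), y)`. A fixed point of it has
`y = (Id + D_N ∘ f ∘ E_N) x`. -/
def iterationMap (φ : HilbertBasis ℕ ℝ X) {N : ℕ}
    (f : EuclideanSpace ℝ (Fin N) → EuclideanSpace ℝ (Fin N)) (p : X × X) : X × X :=
  (p.2 - finiteRankMap φ f p.1, p.2)

/-- The `n`-th iterate `π₁ ∘ (iterationMap ∘ ⋯ ∘ iterationMap) ∘ e₁` at `y`, with `π₁ (x, y) = x`
and `e₁ y = (0, y)`. -/
def fixedPointIterate (φ : HilbertBasis ℕ ℝ X) {N : ℕ}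
    (f : EuclideanSpace ℝ (Fin N) → EuclideanSpace ℝ (Fin N)) (n : ℕ) (y : X) : X :=
  ((iterationMap φ f)^[n] (0, y)).1

/-- `L(y) = lim_{n → ∞} π₁ ∘ (iterationMap)^n ∘ e₁ (y)` (meaningful where the limit exists). -/
def iterationLimit (φ : HilbertBasis ℕ ℝ X) {N : ℕ}
    (f : EuclideanSpace ℝ (Fin N) → EuclideanSpace ℝ (Fin N)) (y : X) : X :=
  limUnder atTop (fun n => fixedPointIterate φ f n y)

/-- `Φ = L_1 ∘ L_2 ∘ ⋯ ∘ L_T`. -/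
def inverseNet (φ : HilbertBasis ℕ ℝ X) {N : ℕ}
    (NN : ℕ → EuclideanSpace ℝ (Fin N) → EuclideanSpace ℝ (Fin N)) : ℕ → X → X
  | 0 => id
  | t + 1 => inverseNet φ NN t ∘ iterationLimit φ (NN (t + 1))

end Hilbert

end

/-!
The map `F` is a compact perturbation of the identity, so on a ball it is uniformly approximated by
maps `D_N f E_N + (1 - D_N E_N)` that only move the first `N` coordinates, and `f` is `C¹` with
`c ‖a - b‖ ≤ ‖f a - f b‖` there (`exists_finiteDimensional_reduction`). It remains to approximate
`f` by compositions of maps `id + h` of `ℝᴺ` with `h` a network that is globally bounded by `δ / 2`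
and globally `1/2`-Lipschitz (`residualLayers`). Such bounds are all that the second half of the theorem
needs, with `R' = R`: a block with a contractive residual is strongly monotone, its inverse is the
limit of the fixed point iteration `x ↦ y - h x`, and the bound `δ / 2` controls the growth of the
balls.

* The class of networks is universal (`isUniversal_residualLayers`): every continuous map is locally
  uniformly approximated by globally bounded and Lipschitz networks `U`, and `n⁻¹ U` is in the class
  for large `n`. The networks are built from a gate (the ReLU, or a second difference of the ReCU)
  that vanishes near `-∞`, equals the identity near `∞` and satisfies `q t - q (-t) = t`. Rescaled
  gates approximate maxima, so the lattice form of the Stone-Weierstrass theorem applies.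
* If `h` is `1/2`-Lipschitz, then `id + h` is a limit of compositions
  (`IsUniversal.residualApprox_add_of_half_lipschitz`). The straight path from `id` to `id + h` is
  the flow of fields that are `1`-Lipschitz, and Euler's method with these fields replaced by
  networks converges. Only uniform approximation of the fields is used, because short time steps
  make any Lipschitz constant of the networks harmless.
* The dilations `x ↦ t⁻¹ (f (t x) - f 0)` join `f - f 0` to its derivative at `0`. Consecutive
  dilations differ by a residual map with small Lipschitz constant, which extends from the image of
  the ball to the whole space (`exists_residualApprox_comp_fderiv`).
* The invertible linear map `Df(0)` is joined in the general linear group to the identity or to a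
  coordinate reflection (`inIdentityComponent_or_mul_signFlip`), and the identity component is
  generated by linear maps close to the identity (`InIdentityComponent.residualApprox`). The
  reflection is the map `A`.
-/

noncomputable section

/-! ### Gates built from ReLU and ReCU -/

/-- A gate for the activation `σ`: a Lipschitz function `q` that is a linear combination of
translates of `σ`, vanishes on `(-∞, -1]` and satisfies `q t - q (-t) = t`. It is a version of the
ReLU, and is as smooth as `σ`. -/
structure IsGate (σ q : ℝ → ℝ) : Prop where
  comb : ∃ (p : ℕ) (a b : Fin p → ℝ), ∀ t, q t = ∑ s, a s * σ (t + b s)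
  sub_neg : ∀ t, q t - q (-t) = t
  eq_zero : ∀ t ≤ -1, q t = 0
  lipschitz : ∃ K : ℝ, 0 ≤ K ∧ ∀ s t, |q s - q t| ≤ K * |s - t|

theorem isGate_reLU : IsGate reLU reLU where
  comb := ⟨1, fun _ => 1, fun _ => 0, fun t => by simp⟩
  sub_neg t := by
    unfold reLU
    rcases le_total 0 t with h | h
    · rw [max_eq_right h, max_eq_left (by linarith)]; ring
    · rw [max_eq_left h, max_eq_right (by linarith)]; ring
  eq_zero t ht := max_eq_left (by linarith)
  lipschitz := ⟨1, zero_le_one, fun s t => by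
    unfold reLU
    have := abs_max_sub_max_le_abs s t 0
    rw [max_comm 0 s, max_comm 0 t]; linarith⟩

theorem hasDerivAt_reCU (t : ℝ) : HasDerivAt reCU (3 * (max 0 t) ^ 2) t := by
  rcases lt_trichotomy t 0 with h | rfl | h
  · have : reCU =ᶠ[𝓝 t] fun _ => (0 : ℝ) := by
      filter_upwards [gt_mem_nhds h] with s hs
      simp [reCU, max_eq_left (le_of_lt hs)]
    rw [max_eq_left h.le]
    simpa using (hasDerivAt_const t (0 : ℝ)).congr_of_eventuallyEq this
  · have hbig : (fun s : ℝ => reCU s) =o[𝓝 0] fun s => s := by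
      have h1 : (fun s : ℝ => s ^ 3) =o[𝓝 0] fun s => s := by
        simpa using Asymptotics.isLittleO_pow_pow (𝕜 := ℝ) (m := 1) (n := 3) (by norm_num)
      refine Asymptotics.IsBigO.trans_isLittleO ?_ h1
      refine Asymptotics.IsBigO.of_bound 1 (Eventually.of_forall fun s => ?_)
      rw [one_mul, reCU, norm_pow, norm_pow]
      gcongr
      rw [Real.norm_eq_abs, Real.norm_eq_abs, abs_of_nonneg (le_max_left _ _)]
      exact max_le (abs_nonneg _) (le_abs_self _)
    rw [hasDerivAt_iff_isLittleO]
    simpa [reCU] using hbig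
  · have : reCU =ᶠ[𝓝 t] fun s => s ^ 3 := by
      filter_upwards [lt_mem_nhds h] with s hs
      simp [reCU, max_eq_right (le_of_lt hs)]
    rw [max_eq_right h.le]
    simpa using (hasDerivAt_pow 3 t).congr_of_eventuallyEq this

theorem contDiff_reCU : ContDiff ℝ 1 reCU := by
  rw [contDiff_one_iff_deriv]
  refine ⟨fun t => (hasDerivAt_reCU t).differentiableAt, ?_⟩
  have : deriv reCU = fun t => 3 * (max 0 t) ^ 2 := funext fun t => (hasDerivAt_reCU t).deriv
  rw [this]
  fun_prop

/-- The second difference of the ReCU, normalised to be `0` on `(-∞, -1]` and the identity on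
`[1, ∞)`. -/
def reCUGate (t : ℝ) : ℝ := (reCU (t + 1) - 2 * reCU t + reCU (t - 1)) / 6

theorem contDiff_reCUGate : ContDiff ℝ 1 reCUGate := by
  have := contDiff_reCU
  unfold reCUGate
  fun_prop

theorem hasDerivAt_reCUGate (t : ℝ) : HasDerivAt reCUGate
    ((max 0 (t + 1) ^ 2 - 2 * max 0 t ^ 2 + max 0 (t - 1) ^ 2) / 2) t := by
  have h1 := (hasDerivAt_reCU (t + 1)).comp_add_const t 1
  have h2 := (hasDerivAt_reCU (t - 1)).comp_sub_const t 1
  have h3 := (hasDerivAt_reCU t).const_mul 2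
  exact (((h1.sub h3).add h2).div_const 6).congr_deriv (by ring)

theorem reCU_sub_neg (t : ℝ) : reCU t - reCU (-t) = t ^ 3 := by
  unfold reCU
  rcases le_total 0 t with h | h
  · rw [max_eq_right h, max_eq_left (by linarith)]; ring
  · rw [max_eq_left h, max_eq_right (by linarith)]; ring

theorem isGate_reCUGate : IsGate reCU reCUGate where
  comb := ⟨3, ![1 / 6, -1 / 3, 1 / 6], ![1, 0, -1], fun t => by
    simp [Fin.sum_univ_three, reCUGate, ← sub_eq_add_neg]; ring⟩
  sub_neg t := by
    have h1 := reCU_sub_neg (t + 1)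
    have h2 := reCU_sub_neg (t - 1)
    have h3 := reCU_sub_neg t
    rw [show -(t + 1) = -t - 1 by ring] at h1
    rw [show -(t - 1) = -t + 1 by ring] at h2
    unfold reCUGate
    linear_combination (h1 + h2 - 2 * h3) / 6
  eq_zero t ht := by
    unfold reCUGate reCU
    rw [max_eq_left (by linarith), max_eq_left (by linarith), max_eq_left (by linarith)]
    norm_num
  lipschitz := by
    refine ⟨1, zero_le_one, fun s t => ?_⟩
    have := Convex.norm_image_sub_le_of_norm_hasDerivWithin_le (f := reCUGate) (s := univ) (C := 1)
      (fun x _ => (hasDerivAt_reCUGate x).hasDerivWithinAt) (fun x _ => ?_) convex_univ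
      (mem_univ t) (mem_univ s)
    · simpa using this
    · rw [Real.norm_eq_abs, abs_le]
      rcases le_total 0 (x + 1) with h1 | h1 <;> rcases le_total 0 x with h2 | h2 <;>
        rcases le_total 0 (x - 1) with h3 | h3 <;>
        simp only [max_eq_left, max_eq_right, h1, h2, h3] <;>
        constructor <;> nlinarith

theorem IsGate.abs_sub_max_le {σ q : ℝ → ℝ} (hq : IsGate σ q) :
    ∃ C : ℝ, 0 ≤ C ∧ ∀ t, |q t - max 0 t| ≤ C := by
  obtain ⟨K, hK, hlip⟩ := hq.lipschitz
  refine ⟨2 * K + 1, by positivity, fun t => ?_⟩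
  rcases le_total t (-1) with h | h
  · rw [hq.eq_zero t h, max_eq_left (by linarith)]; simp; positivity
  rcases le_total 1 t with h1 | h1
  · have := hq.sub_neg t
    rw [hq.eq_zero (-t) (by linarith), sub_zero] at this
    rw [this, max_eq_right (by linarith)]; simp; positivity
  · have := hlip t (-1)
    rw [hq.eq_zero (-1) le_rfl, sub_zero, sub_neg_eq_add, abs_of_nonneg (by linarith : 0 ≤ t + 1)]
      at this
    have h2 : |max 0 t| ≤ 1 := by
      rw [abs_of_nonneg (le_max_left _ _)]; exact max_le zero_le_one h1
    calc |q t - max 0 t| ≤ |q t| + |max 0 t| := abs_sub _ _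
      _ ≤ K * (t + 1) + 1 := add_le_add this h2
      _ ≤ 2 * K + 1 := by nlinarith

/-- Rescaling a gate approximates the positive part. -/
theorem IsGate.abs_smul_sub_max_le {σ q : ℝ → ℝ} (hq : IsGate σ q) {η : ℝ} (hη : 0 < η) :
    ∃ c : ℝ, 0 < c ∧ ∀ t, |c * q (c⁻¹ * t) - max 0 t| ≤ η := by
  obtain ⟨C, hC, h⟩ := hq.abs_sub_max_le
  refine ⟨η / (C + 1), by positivity, fun t => ?_⟩
  set c := η / (C + 1) with hc
  have hc0 : 0 < c := by positivity
  have h1 : max 0 t = c * max 0 (c⁻¹ * t) := by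
    rw [mul_max_of_nonneg _ _ hc0.le, mul_zero, mul_inv_cancel_left₀ hc0.ne']
  rw [h1, ← mul_sub, abs_mul, abs_of_pos hc0]
  calc c * |q (c⁻¹ * t) - max 0 (c⁻¹ * t)| ≤ c * C := by gcongr; exact h _
    _ ≤ c * (C + 1) := by gcongr; linarith
    _ = η := by rw [hc]; field_simp

/-! ### Scalar networks -/

theorem IsNeuralNetwork.affineLayer_comp_activate {σ : ℝ → ℝ} {n k m : ℕ}
    {f : EuclideanSpace ℝ (Fin n) → EuclideanSpace ℝ (Fin k)} (hf : IsNeuralNetwork σ f)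
    (W : Matrix (Fin m) (Fin k) ℝ) (b : EuclideanSpace ℝ (Fin m)) :
    IsNeuralNetwork σ (fun x => affineLayer W b (activate σ (f x))) := by
  induction hf with
  | affine W' b' => exact .layer W' b' _ (.affine W b)
  | layer W' b' g _ ih => exact .layer W' b' _ (ih W)

/-- Scalar functions computed by a network with `d` layers of gates `q`. -/
inductive ScalarNet (q : ℝ → ℝ) {n : ℕ} : ℕ → (EuclideanSpace ℝ (Fin n) → ℝ) → Prop
  | affine (w : Fin n → ℝ) (b : ℝ) : ScalarNet q 0 (fun x => ∑ i, w i * x i + b)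
  | layer {d k : ℕ} (a : Fin k → ℝ) (b : ℝ) (u : Fin k → EuclideanSpace ℝ (Fin n) → ℝ)
      (hu : ∀ j, ScalarNet q d (u j)) : ScalarNet q (d + 1) (fun x => ∑ j, a j * q (u j x) + b)

namespace ScalarNet

variable {σ q : ℝ → ℝ} {n d : ℕ} {f g : EuclideanSpace ℝ (Fin n) → ℝ}

theorem mul_add_const (hf : ScalarNet q d f) (c e : ℝ) :
    ScalarNet q d (fun x => c * f x + e) := by
  cases hf with
  | affine w b =>
    convert ScalarNet.affine (q := q) (fun i => c * w i) (c * b + e) using 2 with x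
    rw [mul_add, Finset.mul_sum]; simp only [mul_assoc]; ring
  | layer a b u hu =>
    convert ScalarNet.layer (q := q) (fun i => c * a i) (c * b + e) u hu using 2 with x
    rw [mul_add, Finset.mul_sum]; simp only [mul_assoc]; ring

theorem comp_gate (hf : ScalarNet q d f) : ScalarNet q (d + 1) (fun x => q (f x)) := by
  simpa using ScalarNet.layer (q := q) (fun _ : Fin 1 => 1) 0 (fun _ => f) (fun _ => hf)

theorem neg (hf : ScalarNet q d f) : ScalarNet q d (fun x => - f x) := by
  simpa using hf.mul_add_const (-1) 0

theorem const (b : ℝ) (d : ℕ) :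
    ScalarNet q d (fun _ : EuclideanSpace ℝ (Fin n) => b) := by
  cases d with
  | zero => simpa using ScalarNet.affine (q := q) (0 : Fin n → ℝ) b
  | succ d =>
    simpa using ScalarNet.layer (q := q) (d := d) (Fin.elim0 : Fin 0 → ℝ) b
      (fun j => j.elim0) (fun j => j.elim0)

/-- The identity `t = q t - q (-t)` transports values through a layer, so depths can be matched. -/
theorem add (hq : IsGate σ q) (hf : ScalarNet q d f) (hg : ScalarNet q d g) :
    ScalarNet q (d + 1) (fun x => f x + g x) := by
  convert ScalarNet.layer (q := q) ![1, -1, 1, -1] 0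
    ![f, fun x => - f x, g, fun x => - g x] ?_ using 2 with x
  · simp only [Fin.sum_univ_four, Matrix.cons_val]
    linarith [hq.sub_neg (f x), hq.sub_neg (g x)]
  · intro j
    fin_cases j
    exacts [hf, hf.neg, hg, hg.neg]

theorem succ (hq : IsGate σ q) (hf : ScalarNet q d f) : ScalarNet q (d + 1) f := by
  simpa using hf.add hq (const 0 d)

theorem mono (hq : IsGate σ q) (hf : ScalarNet q d f) {e : ℕ} (h : d ≤ e) : ScalarNet q e f := by
  induction h with
  | refl => exact hf
  | step _ ih => exact ih.succ hq

theorem exists_lipschitz (hq : IsGate σ q) (hf : ScalarNet q d f) :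
    ∃ K : ℝ, 0 ≤ K ∧ ∀ x y, |f x - f y| ≤ K * ‖x - y‖ := by
  obtain ⟨C, hC, hlip⟩ := hq.lipschitz
  induction hf with
  | affine w b =>
    refine ⟨∑ i, |w i|, by positivity, fun x y => ?_⟩
    rw [add_sub_add_right_eq_sub, ← Finset.sum_sub_distrib, Finset.sum_mul]
    refine (Finset.abs_sum_le_sum_abs _ _).trans (Finset.sum_le_sum fun i _ => ?_)
    rw [← mul_sub, abs_mul]
    gcongr
    simpa using PiLp.norm_apply_le (x - y) i
  | layer a b u hu ih =>
    choose K hK h using ih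
    refine ⟨∑ j, |a j| * (C * K j), Finset.sum_nonneg fun j _ => by have := hK j; positivity,
      fun x y => ?_⟩
    rw [add_sub_add_right_eq_sub, ← Finset.sum_sub_distrib, Finset.sum_mul]
    refine (Finset.abs_sum_le_sum_abs _ _).trans (Finset.sum_le_sum fun j _ => ?_)
    rw [← mul_sub, abs_mul, mul_assoc, mul_assoc]
    gcongr
    exact (hlip _ _).trans (by gcongr; exact h j x y)

theorem contDiff (hq : ContDiff ℝ 1 q) (hf : ScalarNet q d f) : ContDiff ℝ 1 f := by
  induction hf with
  | affine w b => fun_prop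
  | layer a b u hu ih =>
    exact (ContDiff.sum fun j _ => contDiff_const.mul (hq.comp (ih j))).add contDiff_const

/-- A tuple of scalar networks of the same depth is a network in the sense of `IsNeuralNetwork`. -/
theorem isNeuralNetwork (hq : IsGate σ q) {m : ℕ} {f : Fin m → EuclideanSpace ℝ (Fin n) → ℝ}
    (hf : ∀ i, ScalarNet q d (f i)) :
    IsNeuralNetwork σ (fun x => (WithLp.toLp 2 (fun i => f i x) : EuclideanSpace ℝ (Fin m))) := by
  obtain ⟨p, α, β, hcomb⟩ := hq.comb
  induction d generalizing m with
  | zero =>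
    have h : ∀ i, ∃ (w : Fin n → ℝ) (b : ℝ), f i = fun x => ∑ j, w j * x j + b := fun i => by
      have hi := hf i
      generalize f i = g at hi ⊢
      cases hi with | affine w b => exact ⟨w, b, rfl⟩
    choose w b hwb using h
    convert IsNeuralNetwork.affine (σ := σ) (Matrix.of w) (WithLp.toLp 2 b) using 2 with x
    ext i
    simp [affineLayer, hwb, Matrix.mulVec, dotProduct]
  | succ d ih =>
    have h : ∀ i, ∃ (k : ℕ) (a : Fin k → ℝ) (b : ℝ)
        (u : Fin k → EuclideanSpace ℝ (Fin n) → ℝ), (∀ j, ScalarNet q d (u j)) ∧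
        f i = fun x => ∑ j, a j * q (u j x) + b := fun i => by
      have hi := hf i
      generalize f i = g at hi ⊢
      cases hi with | layer a b u hu => exact ⟨_, a, b, u, hu, rfl⟩
    choose k a b u hu hf' using h
    -- the hidden units are all the translates of all the arguments of the gates
    let e := Fintype.equivFin ((Σ i, Fin (k i)) × Fin p)
    have hU := ih (m := Fintype.card ((Σ i, Fin (k i)) × Fin p))
      (f := fun κ x => u (e.symm κ).1.1 (e.symm κ).1.2 x + β (e.symm κ).2)
      (fun κ => by simpa using (hu (e.symm κ).1.1 (e.symm κ).1.2).mul_add_const 1 (β (e.symm κ).2))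
    convert hU.affineLayer_comp_activate
      (Matrix.of fun i κ => if (e.symm κ).1.1 = i then
        a (e.symm κ).1.1 (e.symm κ).1.2 * α (e.symm κ).2 else 0) (WithLp.toLp 2 b) using 2 with x
    ext i
    simp only [affineLayer, activate, hf', Matrix.mulVec, dotProduct, PiLp.add_apply,
      Matrix.of_apply]
    congr 1
    rw [Equiv.sum_comp e.symm (fun y : (Σ i, Fin (k i)) × Fin p =>
      (if y.1.1 = i then a y.1.1 y.1.2 * α y.2 else 0) * σ (u y.1.1 y.1.2 x + β y.2)),
      Fintype.sum_prod_type, Fintype.sum_sigma, Finset.sum_eq_single i]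
    · refine Finset.sum_congr rfl fun j _ => ?_
      simp [hcomb, Finset.mul_sum, mul_assoc]
    · intro i' _ hi'
      simp [hi']
    · simp

end ScalarNet

/-! ### Universal approximation -/

section UniversalApproximation

variable {σ q : ℝ → ℝ} {n : ℕ}

/-- The pointwise maximum of two scalar networks is a uniform limit of scalar networks. -/
theorem exists_scalarNet_near_max (hq : IsGate σ q) {d e : ℕ}
    {f g : EuclideanSpace ℝ (Fin n) → ℝ} (hf : ScalarNet q d f) (hg : ScalarNet q e g)
    {η : ℝ} (hη : 0 < η) :
    ∃ (d' : ℕ) (u : EuclideanSpace ℝ (Fin n) → ℝ), ScalarNet q d' u ∧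
      ∀ x, |u x - max (f x) (g x)| ≤ η := by
  obtain ⟨c, hc, h⟩ := hq.abs_smul_sub_max_le hη
  have hf' := hf.mono hq (le_max_left d e)
  have hg' := hg.mono hq (le_max_right d e)
  have h1 := (((hg'.add hq hf'.neg).mul_add_const c⁻¹ 0).comp_gate).mul_add_const c 0
  refine ⟨_, _, (hf'.mono hq (by omega : max d e ≤ max d e + 1 + 1)).add hq h1, fun x => ?_⟩
  have := h (g x - f x)
  rw [show max (f x) (g x) = f x + max 0 (g x - f x) by
    rw [← max_add_add_left]; simp]
  simpa [← sub_eq_add_neg, add_sub_add_left_eq_sub] using this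

/-- Scalar networks are dense in the continuous functions on a ball: their uniform closure is a
lattice that contains the affine functions. -/
theorem exists_scalarNet_near (hq : IsGate σ q) {f : EuclideanSpace ℝ (Fin n) → ℝ}
    (hf : Continuous f) (r : ℝ) {η : ℝ} (hη : 0 < η) :
    ∃ (d : ℕ) (u : EuclideanSpace ℝ (Fin n) → ℝ), ScalarNet q d u ∧
      ∀ x, ‖x‖ ≤ r → |u x - f x| ≤ η := by
  let S := Metric.closedBall (0 : EuclideanSpace ℝ (Fin n)) r
  have : CompactSpace S := isCompact_iff_compactSpace.mp (isCompact_closedBall _ _)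
  let L : Set C(S, ℝ) := {g | ∃ (d : ℕ) (u : EuclideanSpace ℝ (Fin n) → ℝ),
    ScalarNet q d u ∧ ∀ x : S, g x = u x}
  have key : ∀ (g : C(S, ℝ)), (∀ η > 0, ∃ (d : ℕ) (u : EuclideanSpace ℝ (Fin n) → ℝ),
      ScalarNet q d u ∧ ∀ x : S, |u x - g x| ≤ η) → g ∈ closure L := by
    intro g hg
    rw [Metric.mem_closure_iff]
    intro η hη
    obtain ⟨d, u, hu, h⟩ := hg (η / 2) (by positivity)
    obtain ⟨K, hK, hlip⟩ := hu.exists_lipschitz hq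
    have hcont : Continuous u := by
      refine (LipschitzWith.of_dist_le_mul (K := ⟨K, hK⟩) fun x y => ?_).continuous
      rw [Real.dist_eq, dist_eq_norm]; exact hlip x y
    refine ⟨⟨fun x : S => u x, by fun_prop⟩, ⟨d, u, hu, fun x => rfl⟩, ?_⟩
    refine lt_of_le_of_lt ((ContinuousMap.dist_le (by positivity)).2 fun x => ?_) (half_lt_self hη)
    rw [dist_comm, Real.dist_eq]
    exact h x
  have hnear : ∀ g ∈ closure L, ∀ η > 0, ∃ (d : ℕ) (u : EuclideanSpace ℝ (Fin n) → ℝ),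
      ScalarNet q d u ∧ ∀ x : S, |u x - g x| ≤ η := by
    intro g hg η hη
    obtain ⟨g', ⟨d, u, hu, hgu⟩, hd⟩ := Metric.mem_closure_iff.1 hg η hη
    refine ⟨d, u, hu, fun x => ?_⟩
    have := (ContinuousMap.dist_apply_le_dist x).trans hd.le
    rwa [dist_comm, Real.dist_eq, hgu] at this
  have hneg : ∀ g ∈ closure L, -g ∈ closure L := by
    intro g hg
    refine key _ fun η hη => ?_
    obtain ⟨d, u, hu, h⟩ := hnear g hg η hη
    refine ⟨d, _, hu.neg, fun x => ?_⟩
    rw [ContinuousMap.neg_apply, neg_sub_neg, abs_sub_comm]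
    exact h x
  have hsup : ∀ g₁ ∈ closure L, ∀ g₂ ∈ closure L, g₁ ⊔ g₂ ∈ closure L := by
    intro g₁ h₁ g₂ h₂
    refine key _ fun η hη => ?_
    obtain ⟨d, u, hu, hau⟩ := hnear g₁ h₁ (η / 2) (by positivity)
    obtain ⟨e, v, hv, hbv⟩ := hnear g₂ h₂ (η / 2) (by positivity)
    obtain ⟨d', w, hw, h⟩ := exists_scalarNet_near_max hq hu hv (half_pos hη)
    refine ⟨d', w, hw, fun x => ?_⟩
    have h1 := abs_max_sub_max_le_max (u x) (v x) (g₁ x) (g₂ x)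
    have h2 := max_le (hau x) (hbv x)
    have h3 := abs_sub_le (w x) (max (u x) (v x)) (max (g₁ x) (g₂ x))
    rw [ContinuousMap.sup_apply]
    linarith [h x]
  have hinf : ∀ g₁ ∈ closure L, ∀ g₂ ∈ closure L, g₁ ⊓ g₂ ∈ closure L := by
    intro g₁ h₁ g₂ h₂
    have := hneg _ (hsup _ (hneg _ h₁) _ (hneg _ h₂))
    convert this using 1
    ext x
    simp [max_neg_neg]
  have hsep : (closure L).SeparatesPointsStrongly := by
    intro v x y
    have haff : ∀ (w : EuclideanSpace ℝ (Fin n)) (b : ℝ),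
        (⟨fun z : S => ⟪(z : EuclideanSpace ℝ (Fin n)), w⟫ + b, by fun_prop⟩ : C(S, ℝ)) ∈ L :=
      fun w b => ⟨0, _, ScalarNet.affine (fun i => w i) b, fun z => by
        simp [PiLp.inner_apply]⟩
    by_cases hxy : x = y
    · subst hxy
      exact ⟨_, subset_closure (haff 0 (v x)), by simp, by simp⟩
    · -- the affine function along `y - x` with the prescribed values
      let w : EuclideanSpace ℝ (Fin n) := y - x
      have hw : ⟪w, w⟫ ≠ 0 := by
        rw [inner_self_ne_zero]; exact sub_ne_zero.2 fun h => hxy (Subtype.ext h.symm)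
      let t := (v y - v x) / ⟪w, w⟫
      refine ⟨_, subset_closure (haff (t • w) (v x - t * ⟪(x : EuclideanSpace ℝ (Fin n)), w⟫)),
        ?_, ?_⟩
      · simp [inner_smul_right]
      · have h1 : ⟪(y : EuclideanSpace ℝ (Fin n)), w⟫ =
            ⟪w, w⟫ + ⟪(x : EuclideanSpace ℝ (Fin n)), w⟫ := by
          rw [← inner_add_left]; simp [w]
        have h2 : t * ⟪w, w⟫ = v y - v x := div_mul_cancel₀ _ hw
        simp only [ContinuousMap.coe_mk, inner_smul_right, h1]
        linear_combination h2
  have hne : (closure L).Nonempty :=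
    ⟨0, subset_closure ⟨0, _, ScalarNet.const 0 0, fun _ => rfl⟩⟩
  have htop := ContinuousMap.sublattice_closure_eq_top (closure L) hne hinf hsup hsep
  rw [closure_closure] at htop
  have hmem : (⟨fun x : S => f x, by fun_prop⟩ : C(S, ℝ)) ∈ closure L := htop ▸ mem_univ _
  obtain ⟨d, u, hu, h⟩ := hnear _ hmem η hη
  exact ⟨d, u, hu, fun x hx => h ⟨x, by simpa [S] using hx⟩⟩

/-- Clipping the output by two gates makes a network bounded without changing it where it takes
moderate values. -/
theorem exists_bounded_scalarNet_near (hq : IsGate σ q) {f : EuclideanSpace ℝ (Fin n) → ℝ}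
    (hf : Continuous f) (r : ℝ) {η : ℝ} (hη : 0 < η) :
    ∃ (d : ℕ) (u : EuclideanSpace ℝ (Fin n) → ℝ), ScalarNet q d u ∧ (∃ M : ℝ, ∀ x, |u x| ≤ M) ∧
      ∀ x, ‖x‖ ≤ r → |u x - f x| ≤ η := by
  obtain ⟨d, u, hu, h⟩ := exists_scalarNet_near hq hf r hη
  obtain ⟨B, hB⟩ := (isCompact_closedBall (0 : EuclideanSpace ℝ (Fin n))
    r).exists_bound_of_continuousOn hf.continuousOn
  obtain ⟨C, hC, hgate⟩ := hq.abs_sub_max_le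
  have hB0 : ∀ x, ‖x‖ ≤ r → |u x| ≤ |B| + η := fun x hx => by
    have h1 := hB x (by simpa using hx)
    have h2 := abs_sub_abs_le_abs_sub (u x) (f x)
    have h3 := h x hx
    rw [Real.norm_eq_abs] at h1
    linarith [le_abs_self B]
  set b := |B| + η + 1 with hb
  have hbpos : 0 < b := by positivity
  have h1 : ScalarNet q d (fun x => u x + b) := by simpa using hu.mul_add_const 1 b
  have h2 : ScalarNet q d (fun x => u x - b) := by
    simpa [sub_eq_add_neg] using hu.mul_add_const 1 (-b)
  have h3 := (h1.comp_gate.add hq h2.comp_gate.neg).mul_add_const 1 (-b)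
  refine ⟨_, _, h3, ⟨2 * C + 3 * b, fun x => ?_⟩, fun x hx => ?_⟩
  · have e1 := abs_le.1 (hgate (u x + b))
    have e2 := abs_le.1 (hgate (u x - b))
    have e3 : |max 0 (u x + b) - max 0 (u x - b)| ≤ 2 * b := by
      rw [max_comm 0, max_comm 0]
      refine (abs_max_sub_max_le_abs _ _ _).trans ?_
      rw [show u x + b - (u x - b) = 2 * b by ring, abs_of_pos (by positivity)]
    rw [abs_le] at e3 ⊢
    constructor <;> linarith [e1.1, e1.2, e2.1, e2.2, e3.1, e3.2]
  · have e0 := abs_le.1 (hB0 x hx)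
    have e1 : q (u x - b) = 0 := hq.eq_zero _ (by linarith [e0.2])
    have e2 : q (u x + b) = u x + b := by
      have := hq.sub_neg (u x + b)
      rwa [hq.eq_zero (-(u x + b)) (by linarith [e0.1]), sub_zero] at this
    simpa [e1, e2] using h x hx

theorem euclideanSpace_norm_le_sum {m : ℕ} (v : EuclideanSpace ℝ (Fin m)) :
    ‖v‖ ≤ ∑ i, |v i| := by
  rw [EuclideanSpace.norm_eq]
  refine Real.sqrt_le_iff.2 ⟨by positivity, ?_⟩
  simpa [sq_abs] using Finset.sum_sq_le_sq_sum_of_nonneg (s := Finset.univ) (f := fun i => |v i|)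
    fun i _ => abs_nonneg _

/-- Universal approximation by globally bounded, globally Lipschitz networks all of whose scalar
multiples are networks. -/
theorem exists_isNeuralNetwork_near (hq : IsGate σ q) {m : ℕ}
    {h : EuclideanSpace ℝ (Fin n) → EuclideanSpace ℝ (Fin m)} (hh : Continuous h) (r : ℝ)
    {η : ℝ} (hη : 0 < η) :
    ∃ U : EuclideanSpace ℝ (Fin n) → EuclideanSpace ℝ (Fin m),
      (∀ c : ℝ, IsNeuralNetwork σ (fun x => c • U x)) ∧ (∃ M : ℝ, 0 ≤ M ∧ ∀ x, ‖U x‖ ≤ M) ∧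
      (∃ K : ℝ, 0 ≤ K ∧ ∀ x y, ‖U x - U y‖ ≤ K * ‖x - y‖) ∧ (ContDiff ℝ 1 q → ContDiff ℝ 1 U) ∧
      ∀ x, ‖x‖ ≤ r → ‖U x - h x‖ ≤ η := by
  have hi : ∀ i, Continuous fun x => h x i := fun i => by fun_prop
  choose d u hu hM hnear using fun i =>
    exists_bounded_scalarNet_near hq (hi i) r (η := η / (m + 1)) (by positivity)
  choose M hM using hM
  choose K hK hlip using fun i => (hu i).exists_lipschitz hq
  have hM0 : ∀ i, 0 ≤ M i := fun i => (abs_nonneg _).trans (hM i 0)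
  refine ⟨fun x => WithLp.toLp 2 fun i => u i x, fun c => ?_,
    ⟨∑ i, M i, Finset.sum_nonneg fun i _ => hM0 i, fun x =>
      (euclideanSpace_norm_le_sum _).trans (Finset.sum_le_sum fun i _ => hM i x)⟩,
    ⟨∑ i, K i, Finset.sum_nonneg fun i _ => hK i, fun x y =>
      (euclideanSpace_norm_le_sum _).trans ?_⟩, fun hqd => ?_, fun x hx =>
      (euclideanSpace_norm_le_sum _).trans ?_⟩
  · have hc : ∀ i, ScalarNet q (Finset.univ.sup d) (fun x => c * u i x) := fun i => by
      simpa using ((hu i).mono hq (Finset.le_sup (Finset.mem_univ i))).mul_add_const c 0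
    exact ScalarNet.isNeuralNetwork hq hc
  · rw [Finset.sum_mul]
    exact Finset.sum_le_sum fun i _ => hlip i x y
  · rw [contDiff_euclidean]
    exact fun i => (hu i).contDiff hqd
  · calc ∑ i, |((WithLp.toLp 2 fun i => u i x : EuclideanSpace ℝ (Fin m)) - h x) i|
        ≤ ∑ _i : Fin m, η / (m + 1) := Finset.sum_le_sum fun i _ => hnear i x hx
      _ = m * (η / (m + 1)) := by simp
      _ ≤ η := by rw [mul_div_assoc', div_le_iff₀ (by positivity)]; nlinarith

end UniversalApproximation

/-! ### Perturbations of the identity by a contraction -/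

section Perturbation

variable {Y : Type*} [NormedAddCommGroup Y]

theorem norm_sub_le_two_mul_of_half_lipschitz {h : Y → Y}
    (hh : ∀ x y, ‖h x - h y‖ ≤ ‖x - y‖ / 2) (x y : Y) :
    ‖x - y‖ ≤ 2 * ‖(x + h x) - (y + h y)‖ := by
  have h1 : x - y = ((x + h x) - (y + h y)) - (h x - h y) := by abel
  have h2 := norm_sub_le ((x + h x) - (y + h y)) (h x - h y)
  rw [← h1] at h2
  linarith [hh x y]

theorem injective_add_of_half_lipschitz {h : Y → Y}
    (hh : ∀ x y, ‖h x - h y‖ ≤ ‖x - y‖ / 2) : Function.Injective fun x => x + h x := by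
  intro x y hxy
  have := norm_sub_le_two_mul_of_half_lipschitz hh x y
  rw [sub_eq_zero.2 hxy, norm_zero, mul_zero] at this
  exact sub_eq_zero.1 (norm_le_zero_iff.1 this)

/-- The fixed point iteration `z ↦ y - h z` converges to the solution of `x + h x = y`. -/
theorem exists_tendsto_iterate_of_half_lipschitz [CompleteSpace Y] {h : Y → Y}
    (hh : ∀ x y, ‖h x - h y‖ ≤ ‖x - y‖ / 2) (y z₀ : Y) :
    ∃ x, x + h x = y ∧ Tendsto (fun n => (fun z => y - h z)^[n] z₀) atTop (𝓝 x) := by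
  have hc : ContractingWith (1 / 2) fun z => y - h z := by
    refine ⟨by rw [← NNReal.coe_lt_coe]; norm_num, LipschitzWith.of_dist_le_mul fun a b => ?_⟩
    rw [dist_eq_norm, dist_eq_norm, sub_sub_sub_cancel_left, norm_sub_rev]
    have := hh a b
    simp only [NNReal.coe_div, NNReal.coe_one, NNReal.coe_ofNat]
    linarith
  refine ⟨_, ?_, hc.tendsto_iterate_fixedPoint z₀⟩
  have : y - h (hc.fixedPoint _) = hc.fixedPoint _ := hc.fixedPoint_isFixedPt
  rw [eq_comm, ← sub_eq_iff_eq_add]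
  exact this

end Perturbation

/-! ### Compositions of residual maps -/

section Residual

variable {E : Type*} [NormedAddCommGroup E]

/-- The composition `(id + h₁) ∘ (id + h₂) ∘ ⋯` over a list `[h₁, h₂, …]`. -/
def residualComp : List (E → E) → E → E
  | [] => id
  | h :: l => fun x => residualComp l x + h (residualComp l x)

theorem residualComp_append (l₁ l₂ : List (E → E)) (x : E) :
    residualComp (l₁ ++ l₂) x = residualComp l₁ (residualComp l₂ x) := by
  induction l₁ with
  | nil => rfl
  | cons h l ih => simp [residualComp, ih]

/-- `g` is, uniformly on bounded sets, a limit of compositions of residual maps `id + h` with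
`h ∈ 𝓛`. -/
def ResidualApprox (𝓛 : Set (E → E)) (g : E → E) : Prop :=
  ∀ r : ℝ, ∀ ε > 0, ∃ l : List (E → E), (∀ h ∈ l, h ∈ 𝓛) ∧
    ∀ x, ‖x‖ ≤ r → ‖residualComp l x - g x‖ ≤ ε

theorem ResidualApprox.id {𝓛 : Set (E → E)} : ResidualApprox 𝓛 (fun x => x) :=
  fun _ _ hε => ⟨[], by simp, fun x _ => by simpa [residualComp] using hε.le⟩

theorem ResidualApprox.comp [ProperSpace E] {𝓛 : Set (E → E)} {g₁ g₂ : E → E}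
    (h₁ : ResidualApprox 𝓛 g₁) (h₂ : ResidualApprox 𝓛 g₂) (hg₁ : Continuous g₁)
    (hg₂ : Continuous g₂) : ResidualApprox 𝓛 (fun x => g₁ (g₂ x)) := by
  intro r ε hε
  obtain ⟨B, hB⟩ := (isCompact_closedBall (0 : E) r).exists_bound_of_continuousOn hg₂.continuousOn
  have huc := (isCompact_closedBall (0 : E) (B + 1)).uniformContinuousOn_of_continuous
    hg₁.continuousOn
  obtain ⟨θ, hθ, huc⟩ := Metric.uniformContinuousOn_iff.1 huc (ε / 2) (by positivity)
  obtain ⟨l₂, hl₂, happ₂⟩ := h₂ r (min 1 (θ / 2)) (by positivity)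
  obtain ⟨l₁, hl₁, happ₁⟩ := h₁ (B + 1) (ε / 2) (by positivity)
  refine ⟨l₁ ++ l₂, fun h hh => (List.mem_append.1 hh).elim (hl₁ h) (hl₂ h), fun x hx => ?_⟩
  have e1 := hB x (by simpa using hx)
  have e2 := happ₂ x hx
  have e3 : ‖residualComp l₂ x‖ ≤ B + 1 := by
    have := norm_le_norm_add_norm_sub' (residualComp l₂ x) (g₂ x)
    linarith [min_le_left 1 (θ / 2)]
  have e4 := huc (residualComp l₂ x) (by simpa using e3) (g₂ x) (by simp; linarith)
    (by rw [dist_eq_norm]; linarith [min_le_right 1 (θ / 2)])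
  rw [dist_eq_norm] at e4
  rw [residualComp_append]
  have := norm_sub_le_norm_sub_add_norm_sub (residualComp l₁ (residualComp l₂ x))
    (g₁ (residualComp l₂ x)) (g₁ (g₂ x))
  linarith [happ₁ _ e3]

variable [NormedSpace ℝ E]

/-- Every continuous map is, uniformly on bounded sets, a limit of maps `U` all of whose small
multiples belong to `𝓛`. -/
def IsUniversal (𝓛 : Set (E → E)) : Prop :=
  ∀ h : E → E, Continuous h → ∀ r : ℝ, ∀ η > 0, ∃ (U : E → E) (n₀ : ℕ),
    (∀ n : ℕ, n₀ ≤ n → (fun x => (n : ℝ)⁻¹ • U x) ∈ 𝓛) ∧ ∀ x, ‖x‖ ≤ r → ‖U x - h x‖ ≤ η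

/-- A step `id + m⁻¹ v` along a Lipschitz vector field `v` is replaced by many smaller steps along
an approximation `U` of `v`. The error is of second order in `m⁻¹`, whatever the Lipschitz constant
of `U` is. -/
theorem IsUniversal.exists_residualComp_near_step {𝓛 : Set (E → E)} (h𝓛 : IsUniversal 𝓛)
    {v : E → E} (hv : ∀ x y, ‖v x - v y‖ ≤ ‖x - y‖) {r M η : ℝ} (hη : 0 < η)
    (hM : ∀ x, ‖x‖ ≤ r + 1 → ‖v x‖ ≤ M) (hM0 : 0 ≤ M) {m : ℕ} (hm : M + η ≤ m) :
    ∃ l : List (E → E), (∀ h ∈ l, h ∈ 𝓛) ∧ ∀ x, ‖x‖ ≤ r →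
      ‖residualComp l x - (x + (m : ℝ)⁻¹ • v x)‖ ≤ (m : ℝ)⁻¹ * (η + (m : ℝ)⁻¹ * (M + η)) := by
  have hvc : Continuous v := by
    refine (LipschitzWith.of_dist_le_mul (K := 1) fun x y => ?_).continuous
    simpa [dist_eq_norm] using hv x y
  obtain ⟨U, n₀, hU, hnear⟩ := h𝓛 v hvc (r + 1) η hη
  have hm0 : (0 : ℝ) < m := by linarith
  have hm1 : 1 ≤ m := by exact_mod_cast hm0
  set n := max n₀ 1 with hn
  have hn1 : 1 ≤ n := le_max_right _ _
  have hn0 : (0 : ℝ) < n := by exact_mod_cast hn1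
  set s : ℝ := ((m * n : ℕ) : ℝ)⁻¹ with hs
  have hs0 : 0 < s := by rw [hs]; push_cast; positivity
  have hns : n * s = (m : ℝ)⁻¹ := by rw [hs]; push_cast; field_simp
  have hmem : (fun x => s • U x) ∈ 𝓛 := hU _ ((le_max_left n₀ 1).trans
    (by rw [← hn]; exact Nat.le_mul_of_pos_left n hm1))
  refine ⟨List.replicate n fun x => s • U x, fun h hh => List.eq_of_mem_replicate hh ▸ hmem,
    fun x hx => ?_⟩
  have key : ∀ k ≤ n,
      ‖residualComp (List.replicate k fun x => s • U x) x - x‖ ≤ k * s * (M + η) ∧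
      ‖residualComp (List.replicate k fun x => s • U x) x - (x + (k * s) • v x)‖ ≤
        k * s * (η + (m : ℝ)⁻¹ * (M + η)) := by
    intro k
    induction k with
    | zero => simp [residualComp]
    | succ k ih =>
      intro hk
      obtain ⟨ih1, ih2⟩ := ih (by omega)
      simp only [List.replicate_succ, residualComp]
      set y := residualComp (List.replicate k fun x => s • U x) x with hy
      have hks : k * s ≤ (m : ℝ)⁻¹ := by
        rw [← hns]; gcongr; omega
      have e1 : ‖y - x‖ ≤ (m : ℝ)⁻¹ * (M + η) := ih1.trans (by gcongr)
      have e2 : (m : ℝ)⁻¹ * (M + η) ≤ 1 := by rw [inv_mul_le_iff₀ hm0]; linarith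
      have e3 : ‖y‖ ≤ r + 1 := by
        have := norm_le_norm_add_norm_sub' y x
        linarith
      have e4 := hnear y e3
      have e5 : ‖U y‖ ≤ M + η := by
        have := norm_le_norm_add_norm_sub' (U y) (v y)
        linarith [hM y e3]
      have e6 : ‖U y - v x‖ ≤ η + (m : ℝ)⁻¹ * (M + η) := by
        have := norm_sub_le_norm_sub_add_norm_sub (U y) (v y) (v x)
        linarith [hv y x]
      constructor
      · calc ‖y + s • U y - x‖ = ‖(y - x) + s • U y‖ := by congr 1; abel
          _ ≤ k * s * (M + η) + s * (M + η) := by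
            refine (norm_add_le _ _).trans (add_le_add ih1 ?_)
            rw [norm_smul, Real.norm_of_nonneg hs0.le]; gcongr
          _ = _ := by push_cast; ring
      · calc ‖y + s • U y - (x + (((k + 1 : ℕ) : ℝ) * s) • v x)‖
            = ‖(y - (x + (k * s) • v x)) + s • (U y - v x)‖ := by
              congr 1; push_cast; module
          _ ≤ k * s * (η + (m : ℝ)⁻¹ * (M + η)) + s * (η + (m : ℝ)⁻¹ * (M + η)) := by
            refine (norm_add_le _ _).trans (add_le_add ih2 ?_)
            rw [norm_smul, Real.norm_of_nonneg hs0.le]; gcongr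
          _ = _ := by push_cast; ring
  have := (key n le_rfl).2
  rwa [hns] at this

/-- With `p s = id + s h` and `u s = h ∘ (p s)⁻¹`, the map `id + h` is the composition of the steps
`p ((j + 1) / m) = (id + m⁻¹ u (j / m)) ∘ p (j / m)`, and the fields `u s` are `1`-Lipschitz. The
second-order errors of the steps add up to something small. -/
theorem IsUniversal.residualApprox_add_of_half_lipschitz [CompleteSpace E] {𝓛 : Set (E → E)}
    (h𝓛 : IsUniversal 𝓛) {h : E → E} (hh : ∀ x y, ‖h x - h y‖ ≤ ‖x - y‖ / 2) :
    ResidualApprox 𝓛 (fun x => x + h x) := by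
  intro r ε hε
  wlog hr : 0 ≤ r generalizing r
  · -- for negative `r` the ball is empty
    obtain ⟨l, hl, happ⟩ := this 0 le_rfl
    exact ⟨l, hl, fun x hx => happ x (by linarith)⟩
  have hsh : ∀ s : ℝ, s ∈ Icc (0 : ℝ) 1 → ∀ x y, ‖s • h x - s • h y‖ ≤ ‖x - y‖ / 2 := by
    intro s hs x y
    rw [← smul_sub, norm_smul, Real.norm_of_nonneg hs.1]
    nlinarith [hh x y, norm_nonneg (h x - h y), hs.2]
  have hinv : ∀ s : Icc (0 : ℝ) 1, ∀ y, ∃ x, x + (s : ℝ) • h x = y := fun s y =>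
    let ⟨x, hx, _⟩ := exists_tendsto_iterate_of_half_lipschitz (hsh s s.2) y 0
    ⟨x, hx⟩
  choose P hP using hinv
  have hu : ∀ s y z, ‖h (P s y) - h (P s z)‖ ≤ ‖y - z‖ := by
    intro s y z
    have := norm_sub_le_two_mul_of_half_lipschitz (hsh s s.2) (P s y) (P s z)
    rw [hP, hP] at this
    linarith [hh (P s y) (P s z)]
  have hPp : ∀ (s : Icc (0 : ℝ) 1) x, P s (x + (s : ℝ) • h x) = x := fun s x =>
    injective_add_of_half_lipschitz (hsh s s.2) (hP s _)
  have hbound : ∀ s y, ‖h (P s y)‖ ≤ 2 * ‖h 0‖ + ‖y‖ := by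
    intro s y
    have e1 := hu s y ((s : ℝ) • h 0)
    have e2 : P s ((s : ℝ) • h 0) = 0 := by simpa using hPp s 0
    rw [e2] at e1
    have e3 : ‖(s : ℝ) • h 0‖ ≤ ‖h 0‖ := by
      rw [norm_smul, Real.norm_of_nonneg s.2.1]
      exact mul_le_of_le_one_left (norm_nonneg _) s.2.2
    have e4 := norm_le_norm_add_norm_sub' (h (P s y)) (h 0)
    have e5 := norm_sub_le y ((s : ℝ) • h 0)
    linarith
  -- `r₁` bounds the trajectories and their approximations, `M` the fields `u s` nearby
  set r₁ := r + (‖h 0‖ + r) + 1 with hr₁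
  set M := 2 * ‖h 0‖ + (r₁ + 1) with hMdef
  set κ := min 1 ε / 6 with hκ
  have hκ0 : 0 < κ := by positivity
  have hM0 : 0 ≤ M := by positivity
  obtain ⟨m, hm⟩ := exists_nat_ge (max (M + κ) ((M + κ) / κ))
  have hm1 : M + κ ≤ m := (le_max_left _ _).trans hm
  have hm0 : (0 : ℝ) < m := by linarith
  have hm2 : (m : ℝ)⁻¹ * (M + κ) ≤ κ := by
    have := (le_max_right _ _).trans hm
    rw [div_le_iff₀ hκ0] at this
    rw [inv_mul_le_iff₀ hm0]
    linarith
  set ρ := κ + (m : ℝ)⁻¹ * (M + κ) with hρ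
  have hρ0 : 0 ≤ ρ := by positivity
  have hρ3 : 3 * ρ ≤ min 1 ε := by linarith
  set τ := (m : ℝ)⁻¹ with hτ
  have hτ0 : 0 < τ := by positivity
  have hmτ : m * τ = 1 := mul_inv_cancel₀ hm0.ne'
  have hgrowth : ∀ j ≤ m, (1 + τ) ^ j * (j * τ) * ρ ≤ 3 * ρ := by
    intro j hj
    have hjτ : j * τ ≤ 1 := by rw [← hmτ]; gcongr
    have e1 : (1 + τ) ^ j ≤ 3 := by
      calc (1 + τ) ^ j ≤ Real.exp τ ^ j := by
            gcongr; linarith [Real.add_one_le_exp τ]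
        _ = Real.exp (j * τ) := (Real.exp_nat_mul _ _).symm
        _ ≤ Real.exp 1 := Real.exp_le_exp.2 hjτ
        _ ≤ 3 := by linarith [Real.exp_one_lt_d9]
    gcongr
    calc (1 + τ) ^ j * (j * τ) ≤ 3 * 1 := by gcongr
      _ = 3 := by norm_num
  have key : ∀ j ≤ m, ∃ l : List (E → E), (∀ h ∈ l, h ∈ 𝓛) ∧ ∀ x, ‖x‖ ≤ r →
      ‖residualComp l x - (x + (j * τ) • h x)‖ ≤ (1 + τ) ^ j * (j * τ) * ρ := by
    intro j
    induction j with
    | zero => exact fun _ => ⟨[], by simp, fun x _ => by simp [residualComp]⟩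
    | succ j ih =>
      intro hj
      obtain ⟨l, hl, happ⟩ := ih (by omega)
      have hjτ : j * τ ≤ 1 := by rw [← hmτ]; gcongr; omega
      let s : Icc (0 : ℝ) 1 := ⟨j * τ, by positivity, hjτ⟩
      obtain ⟨l', hl', happ'⟩ := h𝓛.exists_residualComp_near_step (hu s) (r := r₁) (M := M) hκ0
        (fun x hx => (hbound s x).trans (by linarith)) hM0 hm1
      refine ⟨l' ++ l, fun h hh => (List.mem_append.1 hh).elim (hl' h) (hl h), fun x hx => ?_⟩
      rw [residualComp_append]
      set y := residualComp l x with hy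
      have e1 := happ x hx
      have e2 : ‖x + (j * τ) • h x‖ ≤ r + (‖h 0‖ + r) := by
        have e3 := hh x 0
        rw [sub_zero] at e3
        have e4 := norm_le_norm_add_norm_sub' (h x) (h 0)
        refine (norm_add_le _ _).trans (add_le_add hx ?_)
        rw [norm_smul, Real.norm_of_nonneg (by positivity)]
        calc j * τ * ‖h x‖ ≤ 1 * ‖h x‖ := by gcongr
          _ ≤ _ := by linarith
      have e3 : ‖y‖ ≤ r₁ := by
        have := norm_le_norm_add_norm_sub' y (x + (j * τ) • h x)
        linarith [hgrowth j (by omega), min_le_left 1 ε]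
      have e4 := happ' y e3
      have e5 := hu s y (x + (j * τ) • h x)
      rw [hPp s x] at e5
      calc ‖residualComp l' y - (x + (((j + 1 : ℕ) : ℝ) * τ) • h x)‖
          = ‖(residualComp l' y - (y + τ • h (P s y))) + (y - (x + (j * τ) • h x)) +
              τ • (h (P s y) - h x)‖ := by congr 1; push_cast; module
        _ ≤ τ * ρ + ‖y - (x + (j * τ) • h x)‖ + τ * ‖y - (x + (j * τ) • h x)‖ := by
          refine norm_add₃_le.trans ?_
          rw [norm_smul, Real.norm_of_nonneg hτ0.le]
          gcongr
        _ = τ * ρ + (1 + τ) * ‖y - (x + (j * τ) • h x)‖ := by ring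
        _ ≤ (1 + τ) ^ (j + 1) * (τ * ρ) + (1 + τ) * ((1 + τ) ^ j * (j * τ) * ρ) := by
          refine add_le_add (le_mul_of_one_le_left (by positivity)
            (one_le_pow₀ (by linarith))) ?_
          gcongr
        _ = _ := by push_cast; ring
  obtain ⟨l, hl, happ⟩ := key m le_rfl
  refine ⟨l, hl, fun x hx => ?_⟩
  have := (happ x hx).trans (hgrowth m le_rfl)
  rw [hmτ, one_smul] at this
  linarith [min_le_right 1 ε]

end Residual

/-! ### Invertible matrices up to the identity component -/

section Matrices

open Matrix

variable {ι : Type*} [Fintype ι] [DecidableEq ι]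

/-- The diagonal matrix that changes the sign of the coordinate `i`. -/
def signFlip {κ : Type*} [DecidableEq κ] (i : κ) : Matrix κ κ ℝ :=
  diagonal (Function.update 1 i (-1))

theorem signFlip_mul_self (i : ι) : signFlip i * signFlip i = 1 := by
  rw [signFlip, diagonal_mul_diagonal, ← diagonal_one]
  congr 1
  ext j
  by_cases h : j = i
  · subst h; simp
  · simp [h]

/-- `signFlip i` as an invertible matrix. -/
def signFlipUnit (i : ι) : (Matrix ι ι ℝ)ˣ :=
  ⟨signFlip i, signFlip i, signFlip_mul_self i, signFlip_mul_self i⟩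

/-- `M` lies in the identity component of the group of invertible matrices. -/
def InIdentityComponent (M : Matrix ι ι ℝ) : Prop :=
  ∃ u ∈ Subgroup.connectedComponentOfOne (Matrix ι ι ℝ)ˣ, M = u

theorem InIdentityComponent.mul {A B : Matrix ι ι ℝ} (hA : InIdentityComponent A)
    (hB : InIdentityComponent B) : InIdentityComponent (A * B) := by
  obtain ⟨u, hu, rfl⟩ := hA
  obtain ⟨v, hv, rfl⟩ := hB
  exact ⟨u * v, mul_mem hu hv, rfl⟩

theorem InIdentityComponent.signFlip_conj {A : Matrix ι ι ℝ} (hA : InIdentityComponent A) (i : ι) :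
    InIdentityComponent (signFlip i * A * signFlip i) := by
  obtain ⟨u, hu, rfl⟩ := hA
  refine ⟨signFlipUnit i * u * (signFlipUnit i)⁻¹, ?_, rfl⟩
  have hc : Continuous fun u : (Matrix ι ι ℝ)ˣ => signFlipUnit i * u * (signFlipUnit i)⁻¹ := by
    fun_prop
  have := hc.image_connectedComponent_subset 1 ⟨u, hu, rfl⟩
  rwa [mul_one, mul_inv_cancel] at this

theorem inIdentityComponent_of_path {A B : ℝ → Matrix ι ι ℝ} (hA : Continuous A)
    (hB : Continuous B) (hAB : ∀ t, A t * B t = 1) (h0 : A 0 = 1) (t : ℝ) :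
    InIdentityComponent (A t) := by
  let f : ℝ → (Matrix ι ι ℝ)ˣ := fun t => ⟨A t, B t, hAB t, mul_eq_one_comm.1 (hAB t)⟩
  have hf : Continuous f := Units.continuous_iff.2 ⟨hA, hB⟩
  have hf0 : f 0 = 1 := Units.ext h0
  refine ⟨f t, ?_, rfl⟩
  have := (isPreconnected_range hf).subset_connectedComponent ⟨0, hf0⟩
  exact this ⟨t, rfl⟩

theorem inIdentityComponent_transvection (i j : ι) (hij : i ≠ j) (c : ℝ) :
    InIdentityComponent (transvection i j c) := by
  have := inIdentityComponent_of_path (A := fun t => transvection i j (t * c))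
    (B := fun t => transvection i j (-(t * c))) ?_ ?_ ?_ ?_ 1
  · simpa using this
  · simp only [transvection]
    refine continuous_const.add (continuous_matrix fun a b => ?_)
    simp only [Matrix.single_apply]
    split_ifs <;> fun_prop
  · simp only [transvection]
    refine continuous_const.add (continuous_matrix fun a b => ?_)
    simp only [Matrix.single_apply]
    split_ifs <;> fun_prop
  · intro t
    rw [transvection_mul_transvection_same i j hij]; simp
  · simp

theorem continuous_diagonal_update {κ : Type*} [DecidableEq κ] {f : ℝ → ℝ} (hf : Continuous f)
    (i : κ) : Continuous fun t => (diagonal (Function.update 1 i (f t)) : Matrix κ κ ℝ) :=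
  Continuous.matrix_diagonal (continuous_const.update i hf)

theorem diagonal_update_mul (i : ι) (a b : ℝ) :
    (diagonal (Function.update 1 i a) * diagonal (Function.update 1 i b) : Matrix ι ι ℝ) =
      diagonal (Function.update 1 i (a * b)) := by
  rw [diagonal_mul_diagonal]
  congr 1
  ext j
  by_cases h : j = i
  · subst h; simp
  · simp [h]

theorem inIdentityComponent_diagonal_update (i : ι) {c : ℝ} (hc : 0 < c) :
    InIdentityComponent (diagonal (Function.update 1 i c) : Matrix ι ι ℝ) := by
  have := inIdentityComponent_of_path
    (A := fun t => diagonal (Function.update (1 : ι → ℝ) i (Real.exp (t * Real.log c))))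
    (B := fun t => diagonal (Function.update (1 : ι → ℝ) i (Real.exp (-(t * Real.log c)))))
    (continuous_diagonal_update (by fun_prop) i) (continuous_diagonal_update (by fun_prop) i)
    (fun t => ?_) (by simp) 1
  · simpa [Real.exp_log hc] using this
  · rw [diagonal_update_mul, ← Real.exp_add]; simp

theorem householder_mul_self {v : ι → ℝ} (hv : v ⬝ᵥ v = 1) :
    (1 - (2 : ℝ) • vecMulVec v v) * (1 - (2 : ℝ) • vecMulVec v v) = 1 := by
  have : vecMulVec v v * vecMulVec v v = vecMulVec v v := by
    rw [vecMulVec_mul_vecMulVec, hv]; simp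
  simp only [sub_mul, mul_sub, one_mul, mul_one, smul_mul_smul, this]
  module

theorem one_sub_vecMulVec_single {κ : Type*} [DecidableEq κ] (i : κ) :
    (1 - (2 : ℝ) • vecMulVec (Pi.single i 1) (Pi.single i 1) : Matrix κ κ ℝ) = signFlip i := by
  ext a b
  simp only [signFlip, Matrix.sub_apply, Matrix.smul_apply, vecMulVec_apply, diagonal_apply,
    one_apply, Pi.single_apply, Function.update_apply, Pi.one_apply, smul_eq_mul]
  split_ifs <;> simp_all; norm_num

/-- Turning the normal vector joins two coordinate reflections. -/
theorem inIdentityComponent_signFlip_mul_signFlip (i j : ι) :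
    InIdentityComponent (signFlip i * signFlip j) := by
  by_cases hij : i = j
  · subst hij
    rw [signFlip_mul_self]
    exact ⟨1, one_mem _, rfl⟩
  let v : ℝ → ι → ℝ := fun t => Real.cos t • Pi.single j 1 + Real.sin t • Pi.single i 1
  let H : ℝ → Matrix ι ι ℝ := fun t => 1 - (2 : ℝ) • vecMulVec (v t) (v t)
  have hv : ∀ t, v t ⬝ᵥ v t = 1 := fun t => by
    simp [v, dotProduct_add, hij, Ne.symm hij, ← sq]
  have hvc : Continuous v := by fun_prop
  have hHc : Continuous H :=
    continuous_const.sub ((hvc.matrix_vecMulVec hvc).fun_const_smul 2)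
  have h0 : H 0 = signFlip j := by
    rw [← one_sub_vecMulVec_single]; simp [H, v]
  have h1 : H (Real.pi / 2) = signFlip i := by
    rw [← one_sub_vecMulVec_single]; simp [H, v]
  have := inIdentityComponent_of_path (A := fun t => H t * signFlip j)
    (B := fun t => signFlip j * H t) (hHc.mul continuous_const) (continuous_const.mul hHc)
    (fun t => ?_) (by rw [h0, signFlip_mul_self]) (Real.pi / 2)
  · rwa [h1] at this
  · rw [mul_assoc, ← mul_assoc (signFlip j), signFlip_mul_self, one_mul]
    exact householder_mul_self (hv t)

/-- Every invertible matrix can be joined to the identity or to a fixed coordinate reflection. -/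
theorem inIdentityComponent_or_mul_signFlip (i₀ : ι) {M : Matrix ι ι ℝ} (hM : M.det ≠ 0) :
    InIdentityComponent M ∨ InIdentityComponent (M * signFlip i₀) := by
  have hmul : ∀ A B : Matrix ι ι ℝ,
      (InIdentityComponent A ∨ InIdentityComponent (A * signFlip i₀)) →
      (InIdentityComponent B ∨ InIdentityComponent (B * signFlip i₀)) →
      (InIdentityComponent (A * B) ∨ InIdentityComponent (A * B * signFlip i₀)) := by
    have hconj : ∀ A B : Matrix ι ι ℝ, A * signFlip i₀ * (signFlip i₀ * B) = A * B := by
      intro A B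
      rw [mul_assoc, ← mul_assoc (signFlip i₀), signFlip_mul_self, one_mul]
    rintro A B (hA | hA) (hB | hB)
    · exact Or.inl (hA.mul hB)
    · exact Or.inr (by rw [mul_assoc]; exact hA.mul hB)
    · refine Or.inr ?_
      have := hA.mul (hB.signFlip_conj i₀)
      rwa [mul_assoc (signFlip i₀), hconj, ← mul_assoc] at this
    · refine Or.inl ?_
      have := hA.mul (hB.signFlip_conj i₀)
      rwa [mul_assoc (signFlip i₀), hconj, mul_assoc B, signFlip_mul_self, mul_one] at this
  have hone : InIdentityComponent (1 : Matrix ι ι ℝ) := ⟨1, one_mem _, rfl⟩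
  have hsingle : ∀ (i : ι) (c : ℝ), c ≠ 0 →
      InIdentityComponent (diagonal (Function.update 1 i c) : Matrix ι ι ℝ) ∨
      InIdentityComponent (diagonal (Function.update 1 i c) * signFlip i₀) := by
    intro i c hc
    rcases lt_or_gt_of_ne hc with h | h
    · have h1 := inIdentityComponent_diagonal_update i (neg_pos.2 h)
      have h2 := h1.mul (inIdentityComponent_signFlip_mul_signFlip i i₀)
      rw [← mul_assoc, signFlip, diagonal_update_mul] at h2
      exact Or.inr (by simpa using h2)
    · exact Or.inl (inIdentityComponent_diagonal_update i h)
  refine diagonal_transvection_induction_of_det_ne_zero _ M hM (fun D hD => ?_)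
    (fun t => Or.inl (inIdentityComponent_transvection t.i t.j t.hij t.c))
    (fun A B _ _ => hmul A B)
  rw [det_diagonal, Finset.prod_ne_zero_iff] at hD
  have : ∀ s : Finset ι,
      InIdentityComponent (diagonal fun i => if i ∈ s then D i else 1 : Matrix ι ι ℝ) ∨
      InIdentityComponent ((diagonal fun i => if i ∈ s then D i else 1) * signFlip i₀) := by
    intro s
    induction s using Finset.induction_on with
    | empty => exact Or.inl (by simpa using hone)
    | insert i s hi ih =>
      have := hmul _ _ (hsingle i (D i) (hD i (Finset.mem_univ i))) ih
      rw [diagonal_mul_diagonal] at this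
      have hD' : (fun j => if j ∈ insert i s then D j else 1) = fun j =>
          Function.update (1 : ι → ℝ) i (D i) j * if j ∈ s then D j else 1 := by
        ext j
        by_cases h : j = i
        · subst h; simp [hi]
        · simp [h]
      rwa [hD']
  simpa using this Finset.univ

/-- The identity component is generated by any neighbourhood of the identity, so each of its
elements is a product of maps `id + h` with `‖h‖ ≤ 1/2`. -/
theorem InIdentityComponent.residualApprox {𝓛 : Set (EuclideanSpace ℝ ι → EuclideanSpace ℝ ι)}
    (h𝓛 : IsUniversal 𝓛) {M : Matrix ι ι ℝ} (hM : InIdentityComponent M) :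
    ResidualApprox 𝓛 (fun x => toEuclideanCLM (𝕜 := ℝ) M x) := by
  obtain ⟨u, hu, rfl⟩ := hM
  let Φ : Matrix ι ι ℝ → (EuclideanSpace ℝ ι →L[ℝ] EuclideanSpace ℝ ι) :=
    fun M => toEuclideanCLM (𝕜 := ℝ) M
  have hΦ : Continuous Φ :=
    (toEuclideanCLM (𝕜 := ℝ) (n := ι)).toAlgEquiv.toLinearMap.continuous_of_finiteDimensional
  let S : Set (Matrix ι ι ℝ)ˣ := {u | ‖Φ u - 1‖ < 1 / 2 ∧ ‖Φ ↑u⁻¹ - 1‖ < 1 / 2}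
  have hS : S ∈ 𝓝 1 := by
    refine IsOpen.mem_nhds ?_ (by simp [S, Φ])
    refine IsOpen.and (isOpen_lt ?_ continuous_const) (isOpen_lt ?_ continuous_const)
    · exact ((hΦ.comp Units.continuous_val).sub continuous_const).norm
    · exact ((hΦ.comp (Units.continuous_val.comp continuous_inv)).sub continuous_const).norm
  have hsmall : ∀ A : Matrix ι ι ℝ, ‖Φ A - 1‖ < 1 / 2 → ResidualApprox 𝓛 fun x => Φ A x := by
    intro A hA
    have := h𝓛.residualApprox_add_of_half_lipschitz (h := fun x => (Φ A - 1) x) fun x y => by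
      rw [← map_sub]
      refine ((Φ A - 1).le_opNorm _).trans ?_
      nlinarith [norm_nonneg (x - y)]
    simpa using this
  have hopen : IsOpen (Subgroup.closure S : Set (Matrix ι ι ℝ)ˣ) :=
    Subgroup.isOpen_of_mem_nhds _ (mem_of_superset hS Subgroup.subset_closure)
  have hmem : u ∈ Subgroup.closure S :=
    (IsClopen.connectedComponent_subset ⟨Subgroup.isClosed_of_isOpen _ hopen, hopen⟩
      (one_mem _)) hu
  clear hu
  have hcomp : ∀ A B : Matrix ι ι ℝ, ResidualApprox 𝓛 (fun x => Φ A x) →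
      ResidualApprox 𝓛 (fun x => Φ B x) → ResidualApprox 𝓛 (fun x => Φ (A * B) x) := by
    intro A B hA hB
    have := hA.comp hB (Φ A).continuous (Φ B).continuous
    simpa [Φ] using this
  have : ResidualApprox 𝓛 (fun x => Φ u x) ∧ ResidualApprox 𝓛 (fun x => Φ ↑u⁻¹ x) := by
    induction hmem using Subgroup.closure_induction with
    | mem v hv => exact ⟨hsmall _ hv.1, hsmall _ hv.2⟩
    | one => simpa [Φ] using ResidualApprox.id
    | mul v w hv hw ihv ihw =>
      refine ⟨hcomp _ _ ihv.1 ihw.1, ?_⟩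
      rw [_root_.mul_inv_rev]
      exact hcomp _ _ ihw.2 ihv.2
    | inv v hv ih => exact ⟨ih.2, by simpa using ih.1⟩
  exact this.1

end Matrices

/-! ### Bilipschitz maps of Euclidean space -/

section Euclidean

/-- The dilations `x ↦ t⁻¹ (f (t x) - f 0)` of `f`, extended by `Df(0)` to `t = 0`. -/
def dilation {E : Type*} [NormedAddCommGroup E] [NormedSpace ℝ E] (f : E → E) (t : ℝ) (x : E) : E :=
  if t = 0 then fderiv ℝ f 0 x else t⁻¹ • (f (t • x) - f 0)

section Dilation

variable {E : Type*} [NormedAddCommGroup E] [NormedSpace ℝ E] {f : E → E}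

theorem hasFDerivAt_dilation (hf : Differentiable ℝ f) (t : ℝ) (x : E) :
    HasFDerivAt (dilation f t) (fderiv ℝ f (t • x)) x := by
  by_cases ht : t = 0
  · have : dilation f t = fderiv ℝ f 0 := by ext x; simp [dilation, ht]
    rw [this, ht, zero_smul]
    exact (fderiv ℝ f 0).hasFDerivAt
  · have : dilation f t = fun x => t⁻¹ • (f (t • x) - f 0) := by ext x; simp [dilation, ht]
    rw [this]
    have h1 : HasFDerivAt (fun x : E => t • x) (t • ContinuousLinearMap.id ℝ E) x :=
      (hasFDerivAt_id x).const_smul t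
    have h2 := (((hf (t • x)).hasFDerivAt.comp x h1).sub_const (f 0)).const_smul t⁻¹
    refine h2.congr_fderiv ?_
    ext v
    simp [ht]

theorem norm_sub_le_dilation (hf : Differentiable ℝ f) {R c : ℝ} (hR : 0 < R)
    (hlow : ∀ x y, ‖x‖ ≤ R → ‖y‖ ≤ R → c * ‖x - y‖ ≤ ‖f x - f y‖) {t : ℝ} (ht : t ∈ Icc (0 : ℝ) 1)
    {x y : E} (hx : ‖x‖ ≤ R) (hy : ‖y‖ ≤ R) :
    c * ‖x - y‖ ≤ ‖dilation f t x - dilation f t y‖ := by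
  rcases ht.1.eq_or_lt with h0 | h0
  · subst h0
    simp only [dilation, if_true, ← map_sub]
    set v := x - y
    have h1 : Tendsto (fun n : ℝ => n • (f (0 + n⁻¹ • v) - f 0)) atTop (𝓝 (fderiv ℝ f 0 v)) :=
      (hf 0).hasFDerivAt.lim_real v
    refine ge_of_tendsto h1.norm ?_
    have h2 : Tendsto (fun n : ℝ => n⁻¹ * ‖v‖) atTop (𝓝 0) := by
      simpa using tendsto_inv_atTop_zero.mul_const ‖v‖
    filter_upwards [h2.eventually (gt_mem_nhds hR), eventually_gt_atTop 0] with n hn hn0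
    have h3 : ‖n⁻¹ • v‖ = n⁻¹ * ‖v‖ := by
      rw [norm_smul, Real.norm_of_nonneg (by positivity)]
    have h4 := hlow (n⁻¹ • v) 0 (by rw [h3]; exact hn.le) (by simpa using hR.le)
    rw [sub_zero, h3] at h4
    rw [zero_add, norm_smul, Real.norm_of_nonneg hn0.le]
    calc c * ‖v‖ = n * (c * (n⁻¹ * ‖v‖)) := by field_simp
      _ ≤ _ := by gcongr
  · have hsc : ∀ z : E, ‖z‖ ≤ R → ‖t • z‖ ≤ R := fun z hz => by
      rw [norm_smul, Real.norm_of_nonneg ht.1]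
      nlinarith [norm_nonneg z, ht.2]
    simp only [dilation, if_neg h0.ne']
    rw [← smul_sub, sub_sub_sub_cancel_right, norm_smul, Real.norm_of_nonneg (by positivity)]
    have h4 := hlow _ _ (hsc x hx) (hsc y hy)
    rw [← smul_sub, norm_smul, Real.norm_of_nonneg ht.1] at h4
    calc c * ‖x - y‖ = t⁻¹ * (c * (t * ‖x - y‖)) := by field_simp
      _ ≤ _ := by gcongr

/-- Nearby dilations are close in the Lipschitz sense, down to `t = 0`: the derivative of
`dilation f t` at `x` is `Df(t x)`, which is uniformly continuous on the ball. -/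
theorem exists_dilation_lipschitz [ProperSpace E] (hf : ContDiff ℝ 1 f) {R : ℝ} (hR : 0 < R)
    {η : ℝ} (hη : 0 < η) :
    ∃ θ > 0, ∀ s ∈ Icc (0 : ℝ) 1, ∀ t ∈ Icc (0 : ℝ) 1, |t - s| < θ → ∀ x y, ‖x‖ ≤ R → ‖y‖ ≤ R →
      ‖(dilation f t x - dilation f s x) - (dilation f t y - dilation f s y)‖ ≤ η * ‖x - y‖ := by
  have huc := (isCompact_closedBall (0 : E) R).uniformContinuousOn_of_continuous
    (hf.continuous_fderiv one_ne_zero).continuousOn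
  obtain ⟨θ, hθ, huc⟩ := Metric.uniformContinuousOn_iff.1 huc η hη
  refine ⟨θ / R, by positivity, fun s hs t ht hst x y hx hy => ?_⟩
  have hsc : ∀ τ ∈ Icc (0 : ℝ) 1, ∀ z : E, ‖z‖ ≤ R → ‖τ • z‖ ≤ R := fun τ hτ z hz => by
    rw [norm_smul, Real.norm_of_nonneg hτ.1]
    nlinarith [norm_nonneg z, hτ.2]
  have hd := hf.differentiable one_ne_zero
  refine (convex_closedBall (0 : E) R).norm_image_sub_le_of_norm_hasFDerivWithin_le
    (f := fun x => dilation f t x - dilation f s x)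
    (fun z _ => ((hasFDerivAt_dilation hd t z).sub (hasFDerivAt_dilation hd s z)).hasFDerivWithinAt)
    (fun z hz => ?_) (by simpa using hy) (by simpa using hx)
  have hz' : ‖z‖ ≤ R := by simpa using hz
  have := huc (t • z) (by simpa using hsc t ht z hz') (s • z) (by simpa using hsc s hs z hz') ?_
  · rw [dist_eq_norm] at this; exact this.le
  · rw [dist_eq_norm, ← sub_smul, norm_smul, Real.norm_eq_abs]
    calc |t - s| * ‖z‖ ≤ |t - s| * R := by gcongr
      _ < θ / R * R := by gcongr
      _ = θ := by field_simp

end Dilation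

/-- If `F₂ - F₁` has a small Lipschitz constant on `K` and `F₁` is bounded below there, then
`F₂ = (id + h) ∘ F₁` on `K` with `h` the Lipschitz extension of `(F₂ - F₁) ∘ F₁⁻¹`. -/
theorem residualApprox_extend_step {E : Type*} [NormedAddCommGroup E] [NormedSpace ℝ E]
    [FiniteDimensional ℝ E] {𝓛 : Set (E → E)} (h𝓛 : IsUniversal 𝓛) {F₁ F₂ : E → E} {K : Set E}
    {c η : ℝ} (hc : 0 < c) (hη : 0 ≤ η) (hηc : lipschitzExtensionConstant E * (η / c) ≤ 1 / 2)
    (hlow : ∀ x ∈ K, ∀ y ∈ K, c * ‖x - y‖ ≤ ‖F₁ x - F₁ y‖)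
    (hdiff : ∀ x ∈ K, ∀ y ∈ K, ‖(F₂ x - F₁ x) - (F₂ y - F₁ y)‖ ≤ η * ‖x - y‖) :
    ∃ g : E → E, Continuous g ∧ ResidualApprox 𝓛 g ∧ ∀ x ∈ K, F₂ x = g (F₁ x) := by
  let P := Function.invFunOn F₁ K
  have hinj : InjOn F₁ K := fun x hx y hy hxy => by
    have := hlow x hx y hy
    rw [hxy, sub_self, norm_zero] at this
    have h0 : ‖x - y‖ = 0 := le_antisymm (by nlinarith) (norm_nonneg _)
    exact sub_eq_zero.1 (norm_eq_zero.1 h0)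
  have hP : ∀ x ∈ K, P (F₁ x) = x := fun x hx => hinj.leftInvOn_invFunOn hx
  have hlip : LipschitzOnWith ⟨η / c, by positivity⟩ (fun y => F₂ (P y) - F₁ (P y)) (F₁ '' K) := by
    refine LipschitzOnWith.of_dist_le_mul ?_
    rintro _ ⟨x, hx, rfl⟩ _ ⟨y, hy, rfl⟩
    rw [dist_eq_norm, dist_eq_norm, hP x hx, hP y hy]
    refine (hdiff x hx y hy).trans ?_
    have := hlow x hx y hy
    calc η * ‖x - y‖ = η / c * (c * ‖x - y‖) := by field_simp
      _ ≤ _ := mul_le_mul_of_nonneg_left this (by positivity)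
  obtain ⟨h, hh, heq⟩ := hlip.extend_finite_dimension
  have hhalf : ∀ x y, ‖h x - h y‖ ≤ ‖x - y‖ / 2 := fun x y => by
    have h1 := hh.dist_le_mul x y
    rw [dist_eq_norm, dist_eq_norm] at h1
    refine h1.trans ?_
    have h2 : ((lipschitzExtensionConstant E * ⟨η / c, by positivity⟩ : NNReal) : ℝ) ≤ 1 / 2 := hηc
    nlinarith [norm_nonneg (x - y)]
  have : CompleteSpace E := FiniteDimensional.complete ℝ E
  refine ⟨fun x => x + h x, continuous_id.add hh.continuous,
    h𝓛.residualApprox_add_of_half_lipschitz hhalf, fun x hx => ?_⟩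
  have := heq ⟨x, hx, rfl⟩
  simp only [hP x hx] at this
  simp [← this]

/-- On a ball, a `C¹` map that is bounded below factors through its derivative at the centre: the
dilations join the two, and consecutive dilations differ by a residual map. -/
theorem exists_residualApprox_comp_fderiv {E : Type*} [NormedAddCommGroup E] [NormedSpace ℝ E]
    [FiniteDimensional ℝ E] {𝓛 : Set (E → E)} (h𝓛 : IsUniversal 𝓛) {f : E → E}
    (hf : ContDiff ℝ 1 f) {R c : ℝ} (hR : 0 < R) (hc : 0 < c)
    (hlow : ∀ x y, ‖x‖ ≤ R → ‖y‖ ≤ R → c * ‖x - y‖ ≤ ‖f x - f y‖) :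
    ∃ g : E → E, Continuous g ∧ ResidualApprox 𝓛 g ∧ ∀ x, ‖x‖ ≤ R → f x = g (fderiv ℝ f 0 x) := by
  have : ProperSpace E := FiniteDimensional.proper ℝ E
  obtain ⟨Λ, hΛdef⟩ : ∃ Λ : ℝ, Λ = lipschitzExtensionConstant E := ⟨_, rfl⟩
  have hΛ : 0 < Λ := hΛdef ▸ lipschitzExtensionConstant_pos E
  have hd := hf.differentiable one_ne_zero
  obtain ⟨θ, hθ, hdil⟩ := exists_dilation_lipschitz hf hR (η := c / (2 * Λ)) (by positivity)
  obtain ⟨m, hm⟩ := exists_nat_gt (1 / θ)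
  have hm0 : (0 : ℝ) < m := lt_trans (by positivity) hm
  have hmθ : 1 / (m : ℝ) < θ := (one_div_lt hθ hm0).1 hm
  have key : ∀ j ≤ m, ∃ g : E → E, Continuous g ∧ ResidualApprox 𝓛 g ∧
      ∀ x, ‖x‖ ≤ R → dilation f (j / m) x = g (fderiv ℝ f 0 x) := by
    intro j
    induction j with
    | zero => exact fun _ => ⟨fun x => x, continuous_id, .id, fun x _ => by simp [dilation]⟩
    | succ j ih =>
      intro hj
      obtain ⟨g, hgc, hg, hgx⟩ := ih (by omega)
      have hjm : (j : ℝ) + 1 ≤ m := by exact_mod_cast hj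
      have hs : (j / m : ℝ) ∈ Icc (0 : ℝ) 1 := ⟨by positivity, by rw [div_le_one hm0]; linarith⟩
      have ht : ((j + 1 : ℕ) / m : ℝ) ∈ Icc (0 : ℝ) 1 :=
        ⟨by positivity, by rw [div_le_one hm0]; push_cast; linarith⟩
      have hst : |((j + 1 : ℕ) / m : ℝ) - j / m| < θ := by
        rw [← sub_div]; push_cast
        rwa [add_sub_cancel_left, abs_of_pos (by positivity)]
      obtain ⟨g', hgc', hg', hgx'⟩ := residualApprox_extend_step h𝓛 (K := {x | ‖x‖ ≤ R})
        (F₁ := dilation f (j / m)) (F₂ := dilation f ((j + 1 : ℕ) / m)) hc (η := c / (2 * Λ))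
        (by positivity) (by rw [← hΛdef]; field_simp; norm_num)
        (fun x hx y hy => norm_sub_le_dilation hd hR hlow hs hx hy)
        (fun x hx y hy => hdil _ hs _ ht hst x y hx hy)
      exact ⟨fun x => g' (g x), hgc'.comp hgc, hg'.comp hg hgc' hgc, fun x hx => by
        rw [hgx' x hx, hgx x hx]⟩
  obtain ⟨g, hgc, hg, hgx⟩ := key m le_rfl
  have : CompleteSpace E := FiniteDimensional.complete ℝ E
  have htrans := h𝓛.residualApprox_add_of_half_lipschitz (h := fun _ => f 0) (fun x y => by
    simp only [sub_self, norm_zero]; positivity)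
  refine ⟨fun x => g x + f 0, by fun_prop, htrans.comp hg (by fun_prop) hgc, fun x hx => ?_⟩
  have := hgx x hx
  rw [div_self hm0.ne'] at this
  simp [dilation, ← this]

open Matrix in
/-- The orientation of the derivative at the centre decides whether a reflection is needed. -/
theorem exists_residualApprox_comp_signFlip {N : ℕ}
    {𝓛 : Set (EuclideanSpace ℝ (Fin N) → EuclideanSpace ℝ (Fin N))} (h𝓛 : IsUniversal 𝓛)
    (i₀ : Fin N) {f : EuclideanSpace ℝ (Fin N) → EuclideanSpace ℝ (Fin N)}
    (hf : ContDiff ℝ 1 f) {R c : ℝ} (hR : 0 < R) (hc : 0 < c)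
    (hlow : ∀ x y, ‖x‖ ≤ R → ‖y‖ ≤ R → c * ‖x - y‖ ≤ ‖f x - f y‖) :
    ∃ (A : Matrix (Fin N) (Fin N) ℝ) (g : EuclideanSpace ℝ (Fin N) → EuclideanSpace ℝ (Fin N)),
      (A = 1 ∨ A = signFlip i₀) ∧ ResidualApprox 𝓛 g ∧
      ∀ x, ‖x‖ ≤ R → f x = g (toEuclideanCLM (𝕜 := ℝ) A x) := by
  obtain ⟨g, hgc, hg, hgx⟩ := exists_residualApprox_comp_fderiv h𝓛 hf hR hc hlow
  set B := fderiv ℝ f 0 with hB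
  obtain ⟨M, hM⟩ : ∃ M, toEuclideanCLM (𝕜 := ℝ) (n := Fin N) M = B :=
    (toEuclideanCLM (𝕜 := ℝ) (n := Fin N)).surjective B
  have hBlow : ∀ x, B x = 0 → x = 0 := by
    intro x hx
    by_contra hx0
    have hxn : 0 < ‖x‖ := norm_pos_iff.2 hx0
    have h1 := norm_sub_le_dilation (hf.differentiable one_ne_zero) hR hlow (t := 0)
      (by simp) (x := (R / ‖x‖) • x) (y := 0)
      (by rw [norm_smul, Real.norm_of_nonneg (by positivity)]; field_simp; rfl)
      (by simpa using hR.le)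
    simp only [dilation, if_true, map_smul, ← hB, hx, smul_zero, map_zero, sub_zero,
      norm_zero] at h1
    rw [norm_smul, Real.norm_of_nonneg (by positivity), div_mul_cancel₀ _ hxn.ne'] at h1
    nlinarith
  have hdet : M.det ≠ 0 := by
    intro h0
    obtain ⟨v, hv, hMv⟩ := exists_mulVec_eq_zero_iff.2 h0
    have := hBlow (WithLp.toLp 2 v) (by rw [← hM, toEuclideanCLM_toLp, hMv]; rfl)
    exact hv (by simpa using congrArg WithLp.ofLp this)
  have hfin : ∀ A : Matrix (Fin N) (Fin N) ℝ, InIdentityComponent A →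
      ResidualApprox 𝓛 fun x => g (toEuclideanCLM (𝕜 := ℝ) A x) := fun A hA =>
    hg.comp (hA.residualApprox h𝓛) hgc (ContinuousLinearMap.continuous _)
  rcases inIdentityComponent_or_mul_signFlip i₀ hdet with h | h
  · exact ⟨1, _, Or.inl rfl, hfin _ h, fun x hx => by simp [hgx x hx, hM]⟩
  · refine ⟨signFlip i₀, _, Or.inr rfl, hfin _ h, fun x hx => ?_⟩
    rw [hgx x hx, ← hM, map_mul, ← mul_apply_eq_comp, mul_assoc, ← map_mul,
      signFlip_mul_self, map_one, mul_one]

end Euclidean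

/-! ### Truncation along the Hilbert basis -/

section Truncation

variable {X : Type*} [NormedAddCommGroup X] [InnerProductSpace ℝ X] (φ : HilbertBasis ℕ ℝ X)

/-- `encode` as a continuous linear map. -/
def encodeCLM (N : ℕ) : X →L[ℝ] EuclideanSpace ℝ (Fin N) :=
  (EuclideanSpace.equiv (Fin N) ℝ).symm.toContinuousLinearMap ∘L
    ContinuousLinearMap.pi fun i : Fin N => innerSL ℝ (φ i)

/-- `decode` as a continuous linear map. -/
def decodeCLM (N : ℕ) : EuclideanSpace ℝ (Fin N) →L[ℝ] X :=
  ∑ i : Fin N, (EuclideanSpace.proj i : EuclideanSpace ℝ (Fin N) →L[ℝ] ℝ).smulRight (φ i)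

theorem encodeCLM_apply (N : ℕ) (x : X) : encodeCLM φ N x = encode φ N x := by
  ext i
  simp [encodeCLM, encode, real_inner_comm]

theorem decodeCLM_apply (N : ℕ) (a : EuclideanSpace ℝ (Fin N)) :
    decodeCLM φ N a = decode φ N a := by
  simp [decodeCLM, decode]

theorem encode_sub (N : ℕ) (x y : X) : encode φ N (x - y) = encode φ N x - encode φ N y := by
  simp only [← encodeCLM_apply, map_sub]

theorem encode_add (N : ℕ) (x y : X) : encode φ N (x + y) = encode φ N x + encode φ N y := by
  simp only [← encodeCLM_apply, map_add]

theorem decode_sub (N : ℕ) (a b : EuclideanSpace ℝ (Fin N)) :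
    decode φ N (a - b) = decode φ N a - decode φ N b := by
  simp only [← decodeCLM_apply, map_sub]

theorem decode_add (N : ℕ) (a b : EuclideanSpace ℝ (Fin N)) :
    decode φ N (a + b) = decode φ N a + decode φ N b := by
  simp only [← decodeCLM_apply, map_add]

theorem inner_decode (N : ℕ) (a : EuclideanSpace ℝ (Fin N)) (x : X) :
    ⟪decode φ N a, x⟫ = ⟪a, encode φ N x⟫ := by
  simp [decode, encode, sum_inner, inner_smul_left, PiLp.inner_apply, real_inner_comm, mul_comm]

theorem encode_decode (N : ℕ) (a : EuclideanSpace ℝ (Fin N)) :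
    encode φ N (decode φ N a) = a := by
  ext i
  have h := φ.orthonormal.comp (fun i : Fin N => (i : ℕ)) Fin.val_injective
  have := h.inner_left_fintype (fun i => a i) i
  simpa [encode, decode] using this

theorem norm_decode (N : ℕ) (a : EuclideanSpace ℝ (Fin N)) : ‖decode φ N a‖ = ‖a‖ := by
  rw [← sq_eq_sq₀ (norm_nonneg _) (norm_nonneg _), ← real_inner_self_eq_norm_sq, inner_decode,
    encode_decode, real_inner_self_eq_norm_sq]

theorem norm_encode_le (N : ℕ) (x : X) : ‖encode φ N x‖ ≤ ‖x‖ := by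
  have h1 := real_inner_le_norm (decode φ N (encode φ N x)) x
  rw [inner_decode, real_inner_self_eq_norm_sq, norm_decode, sq] at h1
  rcases (norm_nonneg (encode φ N x)).eq_or_lt with h | h
  · rw [← h]; exact norm_nonneg _
  · exact le_of_mul_le_mul_left h1 h

/-- The projection error `x - ∑ n < N, ⟪x, φ n⟫ φ n`. -/
def tail (N : ℕ) (x : X) : X := x - decode φ N (encode φ N x)

theorem tail_sub (N : ℕ) (x y : X) : tail φ N (x - y) = tail φ N x - tail φ N y := by
  simp only [tail, encode_sub, decode_sub]; abel

theorem tail_smul (N : ℕ) (c : ℝ) (x : X) : tail φ N (c • x) = c • tail φ N x := by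
  simp only [tail, ← encodeCLM_apply, ← decodeCLM_apply, map_smul, smul_sub]

theorem tail_decode (N : ℕ) (a : EuclideanSpace ℝ (Fin N)) : tail φ N (decode φ N a) = 0 := by
  rw [tail, encode_decode, sub_self]

theorem encode_tail (N : ℕ) (x : X) : encode φ N (tail φ N x) = 0 := by
  rw [tail, encode_sub, encode_decode, sub_self]

theorem inner_tail_left (N : ℕ) (x y : X) : ⟪tail φ N x, y⟫ = ⟪x, tail φ N y⟫ := by
  rw [tail, tail, inner_sub_left, inner_sub_right, inner_decode,
    real_inner_comm (decode φ N _) x, inner_decode, real_inner_comm (encode φ N x)]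

theorem norm_tail_le (N : ℕ) (x : X) : ‖tail φ N x‖ ≤ ‖x‖ := by
  have h0 : tail φ N (tail φ N x) = tail φ N x := by
    conv_lhs => rw [tail, encode_tail]
    simp [← decodeCLM_apply]
  have h1 := real_inner_le_norm (tail φ N x) x
  rw [← h0, inner_tail_left, h0, real_inner_self_eq_norm_sq, sq] at h1
  rcases (norm_nonneg (tail φ N x)).eq_or_lt with h | h
  · rw [← h]; exact norm_nonneg _
  · exact le_of_mul_le_mul_left h1 h

theorem tendsto_tail (x : X) : Tendsto (fun N => tail φ N x) atTop (𝓝 0) := by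
  have h := (φ.hasSum_repr x).tendsto_sum_nat
  have h2 : ∀ N, ∑ i ∈ Finset.range N, φ.repr x i • φ i = decode φ N (encode φ N x) := fun N => by
    rw [Finset.sum_range]
    simp [decode, encode, φ.repr_apply_apply, real_inner_comm]
  simp only [h2] at h
  simpa [tail] using h.const_sub x

/-- Equicontinuity of the projections makes `tendsto_tail` uniform on compact sets. -/
theorem eventually_norm_tail_le_of_isCompact {S : Set X} (hS : IsCompact S) {ε : ℝ} (hε : 0 < ε) :
    ∀ᶠ N in atTop, ∀ y ∈ S, ‖tail φ N y‖ ≤ ε := by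
  obtain ⟨t, _, htf, ht⟩ := hS.finite_cover_balls (half_pos hε)
  have h1 : ∀ᶠ N in atTop, ∀ z ∈ t, ‖tail φ N z‖ < ε / 2 :=
    (eventually_all_finite htf).2 fun z _ =>
      (by simpa using (tendsto_tail φ z).norm :
        Tendsto (fun N => ‖tail φ N z‖) atTop (𝓝 0)).eventually (gt_mem_nhds (half_pos hε))
  filter_upwards [h1] with N hN y hy
  obtain ⟨z, hz, hyz⟩ := mem_iUnion₂.1 (ht hy)
  have h2 := norm_tail_le φ N (y - z)
  rw [tail_sub] at h2
  rw [Metric.mem_ball, dist_eq_norm] at hyz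
  have := norm_le_norm_add_norm_sub' (tail φ N y) (tail φ N z)
  linarith [hN z hz]

/-- Truncating the values of a compact operator. -/
theorem eventually_norm_tail_apply_le {T : X →L[ℝ] X} (hT : IsCompactOperator T) {ε : ℝ}
    (hε : 0 < ε) : ∀ᶠ N in atTop, ∀ x, ‖tail φ N (T x)‖ ≤ ε * ‖x‖ := by
  obtain ⟨S, hS, hsub⟩ :=
    IsCompactOperator.image_closedBall_subset_compact (f := T.toLinearMap) hT 1
  filter_upwards [eventually_norm_tail_le_of_isCompact φ hS hε] with N hN x
  rcases (norm_nonneg x).eq_or_lt with h | h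
  · have : x = 0 := norm_eq_zero.1 h.symm
    have h0 := norm_tail_le φ N 0
    subst this
    simpa using h0
  · have h1 := hN (T (‖x‖⁻¹ • x)) (hsub ⟨_, by simp [norm_smul, h.ne'], rfl⟩)
    rw [map_smul, tail_smul, norm_smul, norm_inv, norm_norm, inv_mul_le_iff₀ h] at h1
    linarith

/-- Truncating the arguments of a compact operator. -/
theorem eventually_norm_apply_tail_le [CompleteSpace X] {T : X →L[ℝ] X}
    (hT : IsCompactOperator T) {ε : ℝ} (hε : 0 < ε) :
    ∀ᶠ N in atTop, ∀ x, ‖T (tail φ N x)‖ ≤ ε * ‖x‖ := by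
  obtain ⟨M, hM⟩ := (eventually_norm_tail_apply_le φ hT (half_pos hε)).exists
  -- the finitely many coordinates `⟪T (tail x), φ i⟫ = ⟪x, tail (T† (φ i))⟫`, `i < M`, remain
  have h1 : ∀ᶠ N in atTop, ∀ i : Fin M,
      ‖tail φ N (ContinuousLinearMap.adjoint T (φ i))‖ < ε / 2 / (M + 1) :=
    eventually_all.2 fun i =>
      (by simpa using (tendsto_tail φ (ContinuousLinearMap.adjoint T (φ i))).norm :
        Tendsto (fun N => ‖tail φ N (ContinuousLinearMap.adjoint T (φ i))‖) atTop
          (𝓝 0)).eventually (gt_mem_nhds (by positivity))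
  filter_upwards [h1] with N hN x
  set y := T (tail φ N x) with hy
  have e1 : ‖tail φ M y‖ ≤ ε / 2 * ‖x‖ :=
    (hM _).trans (by gcongr; exact norm_tail_le φ N x)
  have e2 : ‖decode φ M (encode φ M y)‖ ≤ ε / 2 * ‖x‖ := by
    rw [norm_decode]
    calc ‖encode φ M y‖ ≤ ∑ i, |encode φ M y i| := euclideanSpace_norm_le_sum _
      _ ≤ ∑ _i : Fin M, ε / 2 / (M + 1) * ‖x‖ := by
        refine Finset.sum_le_sum fun i _ => ?_
        have : encode φ M y i = ⟪x, tail φ N (ContinuousLinearMap.adjoint T (φ i))⟫ := by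
          rw [← inner_tail_left, ContinuousLinearMap.adjoint_inner_right]
          rfl
        rw [this]
        refine (abs_real_inner_le_norm _ _).trans ?_
        rw [mul_comm]
        gcongr
        exact (hN i).le
      _ = M * (ε / 2 / (M + 1)) * ‖x‖ := by simp [mul_assoc]
      _ ≤ ε / 2 * ‖x‖ := by
        gcongr
        rw [mul_div_assoc', div_le_iff₀ (by positivity)]; nlinarith
  have e3 : y = tail φ M y + decode φ M (encode φ M y) := by simp [tail]
  rw [e3]
  exact (norm_add_le _ _).trans (by linarith)

/-- A bilipschitz layer is uniformly close on a ball to the trivial extension `D_N f E_N + tail` of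
a map `f` of a Euclidean space which is again `C¹` and bilipschitz. -/
theorem exists_finiteDimensional_reduction [CompleteSpace X] {F : X → X}
    (hF : IsNeuralOperatorLayer F) (hFbi : IsBilipschitz F) {R ε : ℝ} (hR : 0 < R) (hε : 0 < ε) :
    ∃ (N : ℕ) (f : EuclideanSpace ℝ (Fin N) → EuclideanSpace ℝ (Fin N)), 0 < N ∧ ContDiff ℝ 1 f ∧
      (∃ c > 0, ∀ a b, ‖a‖ ≤ R → ‖b‖ ≤ R → c * ‖a - b‖ ≤ ‖f a - f b‖) ∧
      ∀ x, ‖x‖ ≤ R → ‖F x - (decode φ N (f (encode φ N x)) + tail φ N x)‖ ≤ ε := by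
  obtain ⟨T₁, T₂, G, hT₁, hT₂, hG, hFG⟩ := hF
  obtain ⟨c, C, hc, hbi⟩ := hFbi
  let S := closure (T₁ '' Metric.closedBall 0 R)
  have hS : IsCompact S :=
    IsCompactOperator.isCompact_closure_image_closedBall (f := T₁.toLinearMap) hT₁ R
  have hSconv : Convex ℝ S :=
    ((convex_closedBall (0 : X) R).linear_image T₁.toLinearMap).closure
  have hmemS : ∀ x, ‖x‖ ≤ R → T₁ x ∈ S := fun x hx => subset_closure ⟨x, by simpa using hx, rfl⟩
  obtain ⟨M, hM⟩ := hS.exists_bound_of_continuousOn hG.continuous.continuousOn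
  obtain ⟨L, hL⟩ := hS.exists_bound_of_continuousOn
    (hG.continuous_fderiv one_ne_zero).continuousOn
  have hM0 : 0 ≤ M := (norm_nonneg _).trans (hM _ (hmemS 0 (by simpa using hR.le)))
  have hL0 : 0 ≤ L := (norm_nonneg _).trans (hL _ (hmemS 0 (by simpa using hR.le)))
  have hGlip : ∀ x y, ‖x‖ ≤ R → ‖y‖ ≤ R → ‖G (T₁ x) - G (T₁ y)‖ ≤ L * ‖T₁ (x - y)‖ := by
    intro x y hx hy
    rw [map_sub]
    exact hSconv.norm_image_sub_le_of_norm_fderiv_le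
      (fun z _ => hG.differentiable one_ne_zero z) hL (hmemS y hy) (hmemS x hx)
  set ε₁ := min (c / (2 * (L * ‖T₁‖ + 1))) (ε / (2 * (M + 1))) with hε₁
  have hε₁0 : 0 < ε₁ := by positivity
  set ε₂ := ε / (2 * (‖T₂‖ * L * R + 1)) with hε₂
  have hε₂0 : 0 < ε₂ := by positivity
  obtain ⟨N, hN₁, hN₂, hN⟩ := ((eventually_norm_tail_apply_le φ hT₂ hε₁0).and
    ((eventually_norm_apply_tail_le φ hT₁ hε₂0).and (eventually_gt_atTop 0))).exists
  refine ⟨N, fun a => a + encode φ N (T₂ (G (T₁ (decode φ N a)))), hN, ?_,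
    ⟨c / 2, half_pos hc, fun a b ha hb => ?_⟩, fun x hx => ?_⟩
  · simp only [← encodeCLM_apply, ← decodeCLM_apply]
    exact contDiff_id.add ((encodeCLM φ N).contDiff.comp (T₂.contDiff.comp (hG.comp
      (T₁.contDiff.comp (decodeCLM φ N).contDiff))))
  · set x := decode φ N a with hx
    set y := decode φ N b with hy
    have hxR : ‖x‖ ≤ R := by rwa [hx, norm_decode]
    have hyR : ‖y‖ ≤ R := by rwa [hy, norm_decode]
    have e1 : ‖a - b‖ = ‖x - y‖ := by rw [hx, hy, ← decode_sub, norm_decode]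
    have e2 : ‖(a + encode φ N (T₂ (G (T₁ x)))) - (b + encode φ N (T₂ (G (T₁ y))))‖ =
        ‖(F x - F y) - tail φ N (T₂ (G (T₁ x) - G (T₁ y)))‖ := by
      rw [← norm_decode φ N, hFG, hFG]
      congr 1
      rw [decode_sub, decode_add, decode_add, ← hx, ← hy, map_sub, tail_sub, tail, tail]
      abel
    rw [e1, e2]
    have e3 := norm_sub_norm_le (F x - F y) (tail φ N (T₂ (G (T₁ x) - G (T₁ y))))
    have e4 := hN₁ (G (T₁ x) - G (T₁ y))
    have e5 : ‖G (T₁ x) - G (T₁ y)‖ ≤ (L * ‖T₁‖) * ‖x - y‖ := by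
      refine (hGlip x y hxR hyR).trans ?_
      rw [mul_assoc]
      gcongr
      exact T₁.le_opNorm _
    have e6 : ε₁ * (L * ‖T₁‖) ≤ c / 2 := by
      have h0 : 0 ≤ L * ‖T₁‖ := by positivity
      calc ε₁ * (L * ‖T₁‖) ≤ c / (2 * (L * ‖T₁‖ + 1)) * (L * ‖T₁‖ + 1) := by
            gcongr
            · exact min_le_left _ _
            · linarith
        _ = c / 2 := by field_simp
    have e7 : ε₁ * ‖G (T₁ x) - G (T₁ y)‖ ≤ c / 2 * ‖x - y‖ := by
      calc ε₁ * ‖G (T₁ x) - G (T₁ y)‖ ≤ ε₁ * ((L * ‖T₁‖) * ‖x - y‖) := by gcongr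
        _ = ε₁ * (L * ‖T₁‖) * ‖x - y‖ := by ring
        _ ≤ _ := by gcongr
    linarith [(hbi x y).1]
  · set p := decode φ N (encode φ N x) with hp
    have hpR : ‖p‖ ≤ R := by
      rw [hp, norm_decode]; exact (norm_encode_le φ N x).trans hx
    have e1 : F x - (decode φ N (encode φ N x + encode φ N (T₂ (G (T₁ p)))) + tail φ N x) =
        T₂ (G (T₁ x) - G (T₁ p)) + tail φ N (T₂ (G (T₁ p))) := by
      rw [hFG, decode_add, map_sub, tail, tail, ← hp]
      abel
    rw [e1]
    have e2 : ‖T₂ (G (T₁ x) - G (T₁ p))‖ ≤ ε / 2 := by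
      have h1 := hGlip x p hx hpR
      have h2 := hN₂ x
      rw [tail, ← hp] at h2
      calc ‖T₂ (G (T₁ x) - G (T₁ p))‖ ≤ ‖T₂‖ * ‖G (T₁ x) - G (T₁ p)‖ := T₂.le_opNorm _
        _ ≤ ‖T₂‖ * (L * (ε₂ * R)) := by
          gcongr
          exact h1.trans (by gcongr; exact h2.trans (by gcongr))
        _ = ε₂ * (‖T₂‖ * L * R) := by ring
        _ ≤ ε₂ * (‖T₂‖ * L * R + 1) := by gcongr; linarith
        _ = ε / 2 := by rw [hε₂]; field_simp
    have e3 : ‖tail φ N (T₂ (G (T₁ p)))‖ ≤ ε / 2 := by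
      calc ‖tail φ N (T₂ (G (T₁ p)))‖ ≤ ε₁ * ‖G (T₁ p)‖ := hN₁ _
        _ ≤ ε / (2 * (M + 1)) * (M + 1) := by
          gcongr
          · exact min_le_right _ _
          · linarith [hM _ (hmemS p hpR)]
        _ = ε / 2 := by field_simp
    exact (norm_add_le _ _).trans (by linarith)

end Truncation

/-! ### Residual layers -/

section Layers

/-- Networks on `ℝᴺ` that are globally bounded by `δ / 2` and globally `1/2`-Lipschitz, and of class
`C¹` for the ReCU. -/
def residualLayers (σ : ℝ → ℝ) (δ : ℝ) (N : ℕ) :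
    Set (EuclideanSpace ℝ (Fin N) → EuclideanSpace ℝ (Fin N)) :=
  {h | IsNeuralNetwork σ h ∧ (∀ x, ‖h x‖ ≤ δ / 2) ∧ (∀ x y, ‖h x - h y‖ ≤ ‖x - y‖ / 2) ∧
    (σ = reCU → ContDiff ℝ 1 h)}

theorem exists_isGate {σ : ℝ → ℝ} (hσ : σ = reLU ∨ σ = reCU) :
    ∃ q, IsGate σ q ∧ (σ = reCU → ContDiff ℝ 1 q) := by
  rcases hσ with rfl | rfl
  · -- the smoothness claim is vacuous here, as the two activations differ
    refine ⟨reLU, isGate_reLU, fun h => ?_⟩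
    have := congrFun h 2
    norm_num [reLU, reCU] at this
  · exact ⟨reCUGate, isGate_reCUGate, fun _ => contDiff_reCUGate⟩

theorem isUniversal_residualLayers {σ : ℝ → ℝ} (hσ : σ = reLU ∨ σ = reCU) {δ : ℝ} (hδ : 0 < δ)
    (N : ℕ) : IsUniversal (residualLayers σ δ N) := by
  obtain ⟨q, hq, hqd⟩ := exists_isGate hσ
  intro h hh r η hη
  obtain ⟨U, hU, ⟨M, hM, hUM⟩, ⟨K, hK, hUK⟩, hUd, hnear⟩ := exists_isNeuralNetwork_near hq hh r hη
  obtain ⟨n₀, hn₀⟩ := exists_nat_gt (max (2 * M / δ) (2 * K))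
  have hn₀0 : (0 : ℝ) < n₀ :=
    lt_of_le_of_lt (by positivity) ((le_max_right _ _).trans_lt hn₀)
  refine ⟨U, n₀, fun n hn => ⟨hU _, fun x => ?_, fun x y => ?_, fun hs => ?_⟩, hnear⟩
  all_goals have hnn : (n₀ : ℝ) ≤ n := by exact_mod_cast hn
  all_goals have hn0 : (0 : ℝ) < n := hn₀0.trans_le hnn
  · rw [norm_smul, norm_inv, Real.norm_of_nonneg hn0.le, inv_mul_le_iff₀ hn0]
    have := (le_max_left _ _).trans hn₀.le
    rw [div_le_iff₀ hδ] at this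
    nlinarith [hUM x]
  · rw [← smul_sub, norm_smul, norm_inv, Real.norm_of_nonneg hn0.le, inv_mul_le_iff₀ hn0]
    have := (le_max_right _ _).trans hn₀.le
    nlinarith [hUK x y, norm_nonneg (x - y)]
  · exact (hUd (hqd hs)).const_smul (n : ℝ)⁻¹

theorem zero_mem_residualLayers (σ : ℝ → ℝ) {δ : ℝ} (hδ : 0 < δ) (N : ℕ) :
    (fun _ => 0) ∈ residualLayers σ δ N := by
  refine ⟨?_, fun x => by simp; positivity, fun x y => by simp; positivity,
    fun _ => contDiff_const⟩
  convert IsNeuralNetwork.affine (σ := σ) (0 : Matrix (Fin N) (Fin N) ℝ) 0 using 2 with x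
  ext i
  simp [affineLayer]

end Layers

/-! ### Residual blocks on the Hilbert space and their inverses -/

section Blocks

variable {X : Type*} [NormedAddCommGroup X] [InnerProductSpace ℝ X] (φ : HilbertBasis ℕ ℝ X)
  {σ : ℝ → ℝ} {δ : ℝ} {N : ℕ} {h : EuclideanSpace ℝ (Fin N) → EuclideanSpace ℝ (Fin N)}

theorem norm_finiteRankMap_le (hh : h ∈ residualLayers σ δ N) (x : X) :
    ‖finiteRankMap φ h x‖ ≤ δ / 2 := by
  rw [finiteRankMap, norm_decode]; exact hh.2.1 _

theorem norm_finiteRankMap_sub_le (hh : h ∈ residualLayers σ δ N) (x y : X) :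
    ‖finiteRankMap φ h x - finiteRankMap φ h y‖ ≤ ‖x - y‖ / 2 := by
  rw [finiteRankMap, finiteRankMap, ← decode_sub, norm_decode]
  refine (hh.2.2.1 _ _).trans ?_
  rw [← encode_sub]
  gcongr
  exact norm_encode_le φ N _

theorem stronglyMonotoneOn_residualBlock (hh : h ∈ residualLayers σ δ N) (S : Set X) :
    StronglyMonotoneOn (residualBlock φ h) S := by
  refine ⟨1 / 2, by norm_num, fun x _ y _ => ?_⟩
  have h1 : residualBlock φ h x - residualBlock φ h y =
      (x - y) + (finiteRankMap φ h x - finiteRankMap φ h y) := by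
    simp only [residualBlock]; abel
  rw [h1, inner_add_left, real_inner_self_eq_norm_sq]
  have h2 := abs_le.1 (abs_real_inner_le_norm (finiteRankMap φ h x - finiteRankMap φ h y) (x - y))
  have h3 := norm_finiteRankMap_sub_le φ hh x y
  nlinarith [h2.1, norm_nonneg (x - y)]

theorem iterationMap_iterate (n : ℕ) (y : X) :
    (iterationMap φ h)^[n] (0, y) = ((fun z => y - finiteRankMap φ h z)^[n] 0, y) := by
  induction n with
  | zero => rfl
  | succ n ih => rw [Function.iterate_succ_apply', ih, Function.iterate_succ_apply']; rfl

variable [CompleteSpace X]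

theorem iterationLimit_spec (hh : h ∈ residualLayers σ δ N) (y : X) :
    residualBlock φ h (iterationLimit φ h y) = y ∧
      Tendsto (fun n => fixedPointIterate φ h n y) atTop (𝓝 (iterationLimit φ h y)) := by
  obtain ⟨x, hx, hlim⟩ :=
    exists_tendsto_iterate_of_half_lipschitz (norm_finiteRankMap_sub_le φ hh) y 0
  have hlim' : Tendsto (fun n => fixedPointIterate φ h n y) atTop (𝓝 x) := by
    simpa only [fixedPointIterate, iterationMap_iterate] using hlim
  have : iterationLimit φ h y = x := hlim'.limUnder_eq
  rw [this]
  exact ⟨hx, hlim'⟩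

theorem iterationLimit_residualBlock (hh : h ∈ residualLayers σ δ N) (x : X) :
    iterationLimit φ h (residualBlock φ h x) = x :=
  injective_add_of_half_lipschitz (norm_finiteRankMap_sub_le φ hh) (iterationLimit_spec φ hh _).1

theorem isC1DiffeoOntoImage_residualBlock (hh : h ∈ residualLayers σ δ N) (hC : ContDiff ℝ 1 h)
    {U : Set X} (hU : IsOpen U) : IsC1DiffeoOntoImage (residualBlock φ h) U := by
  have hH : ContDiff ℝ 1 (finiteRankMap φ h : X → X) := by
    have : (finiteRankMap φ h : X → X) = fun x => decodeCLM φ N (h (encodeCLM φ N x)) := by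
      ext x; rw [encodeCLM_apply, decodeCLM_apply]; rfl
    rw [this]
    exact (decodeCLM φ N).contDiff.comp (hC.comp (encodeCLM φ N).contDiff)
  have hB : ContDiff ℝ 1 (residualBlock φ h : X → X) := contDiff_id.add hH
  have hright : ∀ y, residualBlock φ h (iterationLimit φ h y) = y := fun y =>
    (iterationLimit_spec φ hh y).1
  have hLc : Continuous (iterationLimit φ h : X → X) := by
    refine (LipschitzWith.of_dist_le_mul (K := 2) fun x y => ?_).continuous
    have := norm_sub_le_two_mul_of_half_lipschitz (norm_finiteRankMap_sub_le φ hh)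
      (iterationLimit φ h x) (iterationLimit φ h y)
    rw [dist_eq_norm, dist_eq_norm]
    change _ ≤ 2 * ‖residualBlock φ h _ - residualBlock φ h _‖ at this
    rwa [hright, hright] at this
  let e : X ≃ₜ X :=
    { toFun := residualBlock φ h
      invFun := iterationLimit φ h
      left_inv := iterationLimit_residualBlock φ hh
      right_inv := hright
      continuous_toFun := hB.continuous
      continuous_invFun := hLc }
  have hsmall : ∀ a, ‖-fderiv ℝ (finiteRankMap φ h : X → X) a‖ < 1 := fun a => by
    rw [norm_neg]
    refine lt_of_le_of_lt (norm_fderiv_le_of_lip' ℝ (C := 1 / 2) (by norm_num)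
      (Eventually.of_forall fun x => ?_)) (by norm_num : (1 / 2 : ℝ) < 1)
    linarith [norm_finiteRankMap_sub_le φ hh x a]
  have hderiv : ∀ a, HasFDerivAt (e : X → X)
      (ContinuousLinearEquiv.unitsEquiv ℝ X (Units.oneSub _ (hsmall a)) : X →L[ℝ] X) a := by
    intro a
    have h1 : HasFDerivAt (fun x => x + finiteRankMap φ h x)
        (ContinuousLinearMap.id ℝ X + fderiv ℝ (finiteRankMap φ h : X → X) a) a :=
      (hasFDerivAt_id a).add (hH.differentiable one_ne_zero a).hasFDerivAt
    refine h1.congr_fderiv ?_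
    ext v
    simp
  exact ⟨hU, e.isOpenMap U hU, hB.contDiffOn, iterationLimit φ h,
    fun x _ => iterationLimit_residualBlock φ hh x, (e.contDiff_symm hderiv hB).contDiffOn⟩

theorem inverseNet_residualNet
    {NN : ℕ → EuclideanSpace ℝ (Fin N) → EuclideanSpace ℝ (Fin N)} {T : ℕ}
    (hNN : ∀ t ∈ Finset.Icc 1 T, NN t ∈ residualLayers σ δ N) (x : X) :
    inverseNet φ NN T (residualNet φ NN T x) = x := by
  induction T with
  | zero => rfl
  | succ t ih =>
    simp only [inverseNet, residualNet, Function.comp_apply]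
    rw [iterationLimit_residualBlock φ (hNN (t + 1) (by simp))]
    exact ih fun s hs => hNN s (by simp at hs ⊢; omega)

end Blocks

/-! ### Residual networks on the Hilbert space -/

section Networks

variable {X : Type*} [NormedAddCommGroup X] [InnerProductSpace ℝ X] (φ : HilbertBasis ℕ ℝ X)
  {N : ℕ}

theorem residualNet_congr {NN NN' : ℕ → EuclideanSpace ℝ (Fin N) → EuclideanSpace ℝ (Fin N)}
    {T : ℕ} (hNN : ∀ t ∈ Finset.Icc 1 T, NN t = NN' t) :
    residualNet φ NN T = residualNet φ NN' T := by
  induction T with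
  | zero => rfl
  | succ t ih =>
    rw [residualNet, residualNet, hNN (t + 1) (by simp),
      ih fun s hs => hNN s (by simp at hs ⊢; omega)]

/-- A composition of residual maps of `ℝᴺ` acts on the first `N` coordinates as a residual network
of `X`, and the remaining coordinates are unchanged. -/
theorem exists_residualNet_eq
    {𝓛 : Set (EuclideanSpace ℝ (Fin N) → EuclideanSpace ℝ (Fin N))}
    (l : List (EuclideanSpace ℝ (Fin N) → EuclideanSpace ℝ (Fin N))) (hl : ∀ h ∈ l, h ∈ 𝓛) :
    ∃ NN : ℕ → EuclideanSpace ℝ (Fin N) → EuclideanSpace ℝ (Fin N),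
      (∀ t ∈ Finset.Icc 1 l.length, NN t ∈ 𝓛) ∧
      ∀ x, residualNet φ NN l.length x =
        decode φ N (residualComp l (encode φ N x)) + tail φ N x := by
  induction l with
  | nil => exact ⟨fun _ _ => 0, by simp, fun x => by simp [residualNet, residualComp, tail]⟩
  | cons h l ih =>
    obtain ⟨NN, hNN, hx⟩ := ih fun h' hh' => hl h' (List.mem_cons_of_mem _ hh')
    refine ⟨Function.update NN (l.length + 1) h, fun t ht => ?_, fun x => ?_⟩
    · by_cases hlt : t = l.length + 1
      · subst hlt
        simpa using hl h List.mem_cons_self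
      · rw [Function.update_of_ne hlt]
        simp at ht
        exact hNN t (by simp; omega)
    · have h1 : residualNet φ (Function.update NN (l.length + 1) h) l.length =
          residualNet φ NN l.length := residualNet_congr φ fun t ht => by
        simp at ht
        rw [Function.update_of_ne (by omega)]
      rw [List.length_cons, residualNet, Function.comp_apply, h1, hx, Function.update_self,
        residualBlock, finiteRankMap, encode_add, encode_decode, encode_tail, add_zero,
        residualComp, decode_add]
      abel

/-- A coordinate reflection of `ℝᴺ` is the restriction of a hyperplane reflection of `X`. -/
theorem exists_reflection_extending {i₀ : Fin N} {A₀ : Matrix (Fin N) (Fin N) ℝ}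
    (hA₀ : A₀ = 1 ∨ A₀ = signFlip i₀) :
    ∃ A : X ≃L[ℝ] X, (A = ContinuousLinearEquiv.refl ℝ X ∨ IsHyperplaneReflection A) ∧
      (∀ x, ‖A x‖ = ‖x‖) ∧
      (∀ x, encode φ N (A x) = Matrix.toEuclideanCLM (𝕜 := ℝ) A₀ (encode φ N x)) ∧
      ∀ x, tail φ N (A x) = tail φ N x := by
  rcases hA₀ with rfl | rfl
  · exact ⟨ContinuousLinearEquiv.refl ℝ X, Or.inl rfl, fun x => rfl, fun x => by simp,
      fun x => rfl⟩
  · have he : ‖φ i₀‖ = 1 := φ.orthonormal.1 i₀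
    let A := ((ℝ ∙ φ i₀)ᗮ.reflection).toContinuousLinearEquiv
    have hA : ∀ x, A x = x - (2 * ⟪x, φ i₀⟫) • φ i₀ := fun x => by
      have : A x = (ℝ ∙ φ i₀)ᗮ.reflection x := rfl
      rw [this, Submodule.reflection_orthogonal_apply, Submodule.reflection_singleton_apply, he,
        real_inner_comm]
      simp only [RCLike.ofReal_real_eq_id, id, one_pow, div_one]
      module
    have hsingle : φ i₀ = decode φ N (EuclideanSpace.single i₀ 1) := by
      simp [decode]
    refine ⟨A, Or.inr ⟨φ i₀, he, hA⟩, fun x => LinearIsometryEquiv.norm_map _ x, fun x => ?_,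
      fun x => ?_⟩
    · rw [hA, encode_sub, ← encodeCLM_apply, ← encodeCLM_apply φ N (_ • _), map_smul,
        encodeCLM_apply, encodeCLM_apply, hsingle, encode_decode, ← hsingle]
      ext j
      by_cases h : j = i₀
      · subst h
        simp [signFlip, Matrix.mulVec_diagonal, encode]
        ring
      · simp [signFlip, Matrix.mulVec_diagonal, encode, h]
    · rw [hA, tail_sub, tail_smul, hsingle, tail_decode, smul_zero, sub_zero]

end Networks

end

theorem mainTheorem5 {X : Type*} [NormedAddCommGroup X] [InnerProductSpace ℝ X] [CompleteSpace X]
    (φ : HilbertBasis ℕ ℝ X) (σ : ℝ → ℝ) (hσ : σ = reLU ∨ σ = reCU)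
    (δ : ℝ) (hδ : δ ∈ Ioo (0 : ℝ) 1) (R : ℝ) (hR : 0 < R)
    (F : X → X) (hF : IsNeuralOperatorLayer F) (hFbi : IsBilipschitz F)
    (ε : ℝ) (hε : ε ∈ Ioo (0 : ℝ) 1) :
    ∃ (T N : ℕ) (NN : ℕ → EuclideanSpace ℝ (Fin N) → EuclideanSpace ℝ (Fin N))
      (G : X → X) (A : X ≃L[ℝ] X),
      0 < T ∧ 0 < N ∧
      -- `G` is a residual network with networks `NN 1, …, NN T`
      (∀ t ∈ Finset.Icc 1 T, IsNeuralNetwork σ (NN t)) ∧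
      G ∈ residualNetworks T N φ σ ∧ G = residualNet φ NN T ∧
      -- `A` is the identity or a reflection
      (A = ContinuousLinearEquiv.refl ℝ X ∨ IsHyperplaneReflection A) ∧
      -- approximation
      (∀ x ∈ Metric.closedBall (0 : X) R, ‖F x - G (A x)‖ ≤ ε) ∧
      -- `Γ t` is the ball of radius `R' + t δ` and `K t` is the image of `A (B(0,R))` under the
      -- first `t` blocks
      ∃ (R' : ℝ) (Γ K : ℕ → Set X), 0 < R' ∧
        (∀ t, Γ t = Metric.ball (0 : X) (R' + t * δ)) ∧
        K 0 = A '' Metric.ball (0 : X) R ∧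
        (∀ t, K (t + 1) = residualBlock φ (NN (t + 1)) '' K t) ∧
        A '' Metric.ball (0 : X) R ⊆ Metric.ball (0 : X) R' ∧
        K T = (G ∘ A) '' Metric.ball (0 : X) R ∧
        (∀ t ∈ Finset.Icc 0 T, K t ⊆ Γ t) ∧
        -- each block is strongly monotone, and a `C¹`-diffeomorphism in the ReCU case
        (∀ t ∈ Finset.Icc 1 T, StronglyMonotoneOn (residualBlock φ (NN t)) (Γ t)) ∧
        (σ = reCU → ∀ t ∈ Finset.Icc 1 T, IsC1DiffeoOntoImage (residualBlock φ (NN t)) (Γ t)) ∧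
        -- the iterations defining `L_t : Γ t → Γ (t + 1)` are well defined and converge
        (∀ t ∈ Finset.Icc 1 T,
          MapsTo (iterationMap φ (NN t)) (Γ (t + 1) ×ˢ Γ t) (Γ (t + 1) ×ˢ Γ t) ∧
          (∀ y ∈ Γ t, Tendsto (fun n => fixedPointIterate φ (NN t) n y) atTop
            (𝓝 (iterationLimit φ (NN t) y))) ∧
          MapsTo (iterationLimit φ (NN t)) (Γ t) (Γ (t + 1)) ∧
          MapsTo (iterationLimit φ (NN t)) (K t) (K (t - 1))) ∧
        -- `G ∘ A` is bijective onto its image, with inverse `A⁻¹ ∘ Φ`, `Φ = L_1 ∘ ⋯ ∘ L_T`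
        BijOn (G ∘ A) (Metric.ball (0 : X) R) ((G ∘ A) '' Metric.ball (0 : X) R) ∧
        MapsTo (inverseNet φ NN T) ((G ∘ A) '' Metric.ball (0 : X) R)
          (A '' Metric.ball (0 : X) R) ∧
        InvOn (A.symm ∘ inverseNet φ NN T) (G ∘ A) (Metric.ball (0 : X) R)
          ((G ∘ A) '' Metric.ball (0 : X) R) := by
  obtain ⟨N, f, hN, hf, ⟨c, hc, hlow⟩, hred⟩ :=
    exists_finiteDimensional_reduction φ hF hFbi hR (half_pos hε.1)
  obtain ⟨A₀, g, hA₀, hg, hgf⟩ := exists_residualApprox_comp_signFlip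
    (isUniversal_residualLayers hσ hδ.1 N) ⟨0, hN⟩ hf hR hc hlow
  obtain ⟨l, hl, hlg⟩ := hg R (ε / 2) (half_pos hε.1)
  obtain ⟨A, hAr, hAn, hAe, hAt⟩ := exists_reflection_extending φ hA₀
  -- a zero layer is added because at least one block is required
  obtain ⟨NN, hNN, hNNx⟩ := exists_residualNet_eq φ (𝓛 := residualLayers σ δ N)
    ((fun _ => 0) :: l) (List.forall_mem_cons.2 ⟨zero_mem_residualLayers σ hδ.1 N, hl⟩)
  set T := ((fun _ => 0) :: l : List (EuclideanSpace ℝ (Fin N) → EuclideanSpace ℝ (Fin N))).length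
    with hT
  have hT0 : 0 < T := by simp [hT]
  have hinv : ∀ x, (A.symm ∘ inverseNet φ NN T) ((residualNet φ NN T ∘ A) x) = x := fun x => by
    simp [inverseNet_residualNet φ hNN]
  let K : ℕ → Set X := fun t => residualNet φ NN t '' (A '' Metric.ball 0 R)
  have hK : ∀ t, K (t + 1) = residualBlock φ (NN (t + 1)) '' K t := fun t => by
    simp only [K, residualNet, image_comp]
  have hAball : A '' Metric.ball (0 : X) R ⊆ Metric.ball 0 R := by
    rintro _ ⟨x, hx, rfl⟩
    simpa [hAn] using hx
  refine ⟨T, N, NN, residualNet φ NN T, A, hT0, hN, fun t ht => (hNN t ht).1,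
    ⟨NN, fun t ht => (hNN t ht).1, rfl⟩, rfl, hAr, fun x hx => ?_,
    R, fun t => Metric.ball (0 : X) (R + t * δ), K, hR, fun t => rfl, by simp [K, residualNet],
    hK, hAball, by simp only [K, image_comp], ?_,
    fun t ht => stronglyMonotoneOn_residualBlock φ (hNN t ht) _,
    fun hs t ht => isC1DiffeoOntoImage_residualBlock φ (hNN t ht) ((hNN t ht).2.2.2 hs)
      Metric.isOpen_ball, fun t ht => ⟨?_, fun y _ => (iterationLimit_spec φ (hNN t ht) y).2,
      ?_, ?_⟩, ⟨mapsTo_image _ _, fun x _ y _ hxy => ?_, surjOn_image _ _⟩, ?_, ?_, ?_⟩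
  · have hxR : ‖x‖ ≤ R := by simpa using hx
    have h1 := hred x hxR
    have h2 := hlg (encode φ N (A x)) ((norm_encode_le φ N _).trans (by rwa [hAn]))
    have h3 : F x - residualNet φ NN T (A x) =
        (F x - (decode φ N (f (encode φ N x)) + tail φ N x)) -
          decode φ N (residualComp l (encode φ N (A x)) - g (encode φ N (A x))) := by
      have h4 : residualComp ((fun _ => 0) :: l) (encode φ N (A x)) =
          residualComp l (encode φ N (A x)) := by simp [residualComp]
      rw [hNNx, h4, hAt, hgf _ ((norm_encode_le φ N _).trans hxR), ← hAe, decode_sub]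
      abel
    rw [h3]
    refine (norm_sub_le _ _).trans ?_
    rw [norm_decode]
    linarith
  · intro t ht
    induction t with
    | zero => simpa [K, residualNet] using hAball
    | succ t ih =>
      have ht' : t + 1 ≤ T := by simpa using ht
      rw [hK]
      rintro _ ⟨x, hx, rfl⟩
      have h1 := ih (by simp; omega) hx
      have h2 := norm_finiteRankMap_le φ (hNN (t + 1) (by simp; omega)) x
      rw [mem_ball_zero_iff] at h1 ⊢
      have h3 := norm_add_le x (finiteRankMap φ (NN (t + 1)) x)
      push_cast
      rw [residualBlock]
      linarith [hδ.1]
  · rintro ⟨x, y⟩ ⟨_, hy⟩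
    refine ⟨?_, hy⟩
    have h1 := norm_finiteRankMap_le φ (hNN t ht) x
    simp only [iterationMap, mem_ball_zero_iff] at hy ⊢
    have h3 := norm_sub_le y (finiteRankMap φ (NN t) x)
    push_cast
    linarith [hδ.1]
  · intro y hy
    have h0 := (iterationLimit_spec φ (hNN t ht) y).1
    set x := iterationLimit φ (NN t) y
    have h1 := norm_finiteRankMap_le φ (hNN t ht) x
    have h2 : x = y - finiteRankMap φ (NN t) x := eq_sub_of_add_eq h0
    have h3 := norm_sub_le y (finiteRankMap φ (NN t) x)
    rw [← h2] at h3
    rw [mem_ball_zero_iff] at hy ⊢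
    push_cast
    linarith [hδ.1]
  · obtain ⟨s, rfl⟩ : ∃ s, t = s + 1 := ⟨t - 1, by simp at ht; omega⟩
    rw [hK]
    rintro _ ⟨x, hx, rfl⟩
    rw [iterationLimit_residualBlock φ (hNN _ ht)]
    simpa using hx
  · rw [← hinv x, hxy, hinv]
  · rintro _ ⟨x, hx, rfl⟩
    rw [Function.comp_apply, inverseNet_residualNet φ hNN]
    exact mem_image_of_mem _ hx
  · exact fun x _ => hinv x
  · rintro _ ⟨x, _, rfl⟩
    rw [hinv]
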